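/- Let $(\mathcal C,\otimes,I,\sigma)$ be a symmetric monoidal category (associativity and unit isomorphisms are suppressed). An associative Hopf algebra in $\mathcal C$ is an object with an associative unital multiplication $(m,u)$, a coassociative counital comultiplication $(\Delta,\epsilon)$ making it a bialgebra, and an antipode $S$ with $m(S\otimes 1)\Delta=u\epsilon=m(1\otimes S)\Delta$. A morphism of Hopf algebras is a morphism of $\mathcal C$ that is a morphism of algebras and of coalgebras (it then commutes with the antipodes). A split extension of associative Hopf algebras consists of associative Hopf algebras $X,A,B$, Hopf algebra morphisms $\kappa\colon X\to A$, $\alpha\colon A\to B$, $e\colon B\to A$ and a morphism of coalgebras $\lambda\colon A\to X$ preserving the unit, such that $\lambda\kappa=1_X$, $\alpha e=1_B$, $\lambda e=u_X\epsilon_B$, $\alpha\kappa=u_B\epsilon_X$, $m((\kappa\lambda)\otimes(e\alpha))\Delta=1_A$, $\lambda m(\kappa\otimes e)=1_X\otimes\epsilon_B$, and $$(1_B\otimes\lambda m(e\otimes\kappa))(\Delta\otimes1_X)=(1_B\otimes\lambda m(e\otimes\kappa))(\sigma_{B,B}\otimes1_X)(\Delta\otimes1_X).$$ A morphism of split extensions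 is a triple of Hopf algebra morphisms $g\colon B\to B'$, $v\colon X\to X'$, $p\colon A\to A'$ with $p\kappa=\kappa'v$, $pe=e'g$, $g\alpha=\alpha'p$, $v\lambda=\lambda'p$. An action of associative Hopf algebras consists of associative Hopf algebras $B,X$ and a morphism of coalgebras $\triangleright\colon B\otimes X\to X$ in $\mathcal C$ such that $\triangleright(u_B\otimes1_X)=1_X$, $\triangleright(1_B\otimes u_X)=u_X\epsilon_B$, $(1_B\otimes\triangleright)(\Delta\otimes1_X)=(1_B\otimes\triangleright)(\sigma_{B,B}\otimes1_X)(\Delta\otimes1_X)$, $\triangleright(m\otimes1_X)=\triangleright(1_B\otimes\triangleright)$ and $\triangleright(1_B\otimes m)=m(\triangleright\otimes\triangleright)(1_B\otimes\sigma_{B,X}\otimes1_X)(\Delta\otimes1_X\otimes1_X)$. A morphism of actions is a pair of Hopf algebra morphisms $g\colon B\to B'$, $v\colon X\to X'$ with $v\,\triangleright=\triangleright'(g\otimes v)$. (1) For every symmetric monoidal category $\mathcal C$, the category of split extensions of associative Hopf algebras in $\mathcal C$ and the category of actions of associative Hopf algebras in $\mathcal C$ are equivalent, by an equivalence which (up to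 natural isomorphisms of Hopf algebras $B$ and $X$) sends a split extension to the action $\triangleright=\lambda m(e\otimes\kappa)$ of $B$ on $X$ and a morphism $(g,v,p)$ to $(g,v)$. (2) Let $\mathcal C=\mathsf{Set}$ with the cartesian product, where associative Hopf algebras are groups. Then (1) becomes the classical equivalence between split extensions of groups and group actions. That is: forgetting $\lambda$ is an equivalence from split extensions of associative Hopf algebras in $\mathsf{Set}$ to split extensions of groups $1\to X\to A\rightleftarrows B\to1$; actions of associative Hopf algebras in $\mathsf{Set}$ are equivalent, by the evident functor, to actions of groups on groups by automorphisms; the classical functor, sending a split extension of groups to the conjugation action of $B$ on $X$ through the section, is an equivalence; and under these comparisons an equivalence as in (1) corresponds, up to natural isomorphism, to the classical one. -/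

import Mathlib

open CategoryTheory MonoidalCategory
open scoped MonObj ComonObj

/-! ### Split extensions of associative Hopf algebras

Associative Hopf algebras in `C` are Mathlib's `HopfObj`s, and their morphisms are the morphisms of
`C` satisfying `IsBimonHom` (such morphisms commute with the antipodes automatically). -/

/-- A split extension `X ⇄ A ⇄ B` of associative Hopf algebras in `C`: Hopf algebra morphisms
`κ : X ⟶ A`, `α : A ⟶ B`, `e : B ⟶ A`, and a morphism of coalgebras `ret : A ⟶ X` preserving the
unit (drawn as a dashed arrow in the usual diagram), subject to the axioms below. -/
structure HopfSplitExt (C : Type*) [Category* C] [MonoidalCategory C] [SymmetricCategory C] where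
  /-- the kernel object -/
  X : C
  /-- the total object -/
  A : C
  /-- the quotient object -/
  B : C
  [hopfX : HopfObj X]
  [hopfA : HopfObj A]
  [hopfB : HopfObj B]
  κ : X ⟶ A
  α : A ⟶ B
  e : B ⟶ A
  /-- the (dashed) retraction of `κ`; not a morphism of algebras in general -/
  ret : A ⟶ X
  [isBimonHom_κ : IsBimonHom κ]
  [isBimonHom_α : IsBimonHom α]
  [isBimonHom_e : IsBimonHom e]
  κ_ret : κ ≫ ret = 𝟙 X
  e_α : e ≫ α = 𝟙 B
  e_ret : e ≫ ret = ε[B] ≫ η[X]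
  κ_α : κ ≫ α = ε[X] ≫ η[B]
  /-- `m · ((κ · λ) ⊗ (e · α)) · Δ = 1_A` -/
  decomp : Δ[A] ≫ ((ret ≫ κ) ⊗ₘ (α ≫ e)) ≫ μ[A] = 𝟙 A
  /-- `λ · m · (κ ⊗ e) = 1_X ⊗ ε_B` -/
  mul_ret : (κ ⊗ₘ e) ≫ μ[A] ≫ ret = X ◁ ε[B] ≫ (ρ_ X).hom
  /-- `(1 ⊗ λ) · (1 ⊗ m) · (1 ⊗ e ⊗ κ) · (Δ ⊗ 1)` is unchanged when `σ ⊗ 1` is inserted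
  after `Δ ⊗ 1` -/
  cocomm : Δ[B] ▷ X ≫ (α_ B B X).hom ≫ B ◁ ((e ⊗ₘ κ) ≫ μ[A] ≫ ret) =
    Δ[B] ▷ X ≫ (β_ B B).hom ▷ X ≫ (α_ B B X).hom ≫ B ◁ ((e ⊗ₘ κ) ≫ μ[A] ≫ ret)
  [isComonHom_ret : IsComonHom ret]
  one_ret : η[A] ≫ ret = η[X]

namespace HopfSplitExt

attribute [instance] hopfX hopfA hopfB isBimonHom_κ isBimonHom_α isBimonHom_e isComonHom_ret

variable {C : Type*} [Category* C] [MonoidalCategory C] [SymmetricCategory C]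

/-- Morphisms of split extensions: triples of Hopf algebra morphisms making the whole diagram
commute. -/
@[ext]
structure Hom (S T : HopfSplitExt C) where
  g : S.B ⟶ T.B
  v : S.X ⟶ T.X
  p : S.A ⟶ T.A
  [isBimonHom_g : IsBimonHom g]
  [isBimonHom_v : IsBimonHom v]
  [isBimonHom_p : IsBimonHom p]
  κ_comm : S.κ ≫ p = v ≫ T.κ
  e_comm : S.e ≫ p = g ≫ T.e
  α_comm : S.α ≫ g = p ≫ T.α
  ret_comm : S.ret ≫ v = p ≫ T.ret

attribute [instance] Hom.isBimonHom_g Hom.isBimonHom_v Hom.isBimonHom_p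

theorem isBimonHom_id (M : C) [HopfObj M] : IsBimonHom (𝟙 M) where

theorem isBimonHom_comp {M N P : C} [HopfObj M] [HopfObj N] [HopfObj P] (f : M ⟶ N) (h : N ⟶ P)
    [IsBimonHom f] [IsBimonHom h] : IsBimonHom (f ≫ h) where

/-- The category of split extensions of associative Hopf algebras in `C`. -/
instance : Category (HopfSplitExt C) where
  Hom S T := Hom S T
  id S :=
    { g := 𝟙 _, v := 𝟙 _, p := 𝟙 _
      isBimonHom_g := isBimonHom_id _
      isBimonHom_v := isBimonHom_id _
      isBimonHom_p := isBimonHom_id _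
      κ_comm := by simp
      e_comm := by simp
      α_comm := by simp
      ret_comm := by simp }
  comp f h :=
    { g := f.g ≫ h.g, v := f.v ≫ h.v, p := f.p ≫ h.p
      isBimonHom_g := isBimonHom_comp _ _
      isBimonHom_v := isBimonHom_comp _ _
      isBimonHom_p := isBimonHom_comp _ _
      κ_comm := by rw [← Category.assoc, f.κ_comm, Category.assoc, h.κ_comm, Category.assoc]
      e_comm := by rw [← Category.assoc, f.e_comm, Category.assoc, h.e_comm, Category.assoc]
      α_comm := by rw [← Category.assoc, f.α_comm, Category.assoc, h.α_comm, Category.assoc]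
      ret_comm := by
        rw [← Category.assoc, f.ret_comm, Category.assoc, h.ret_comm, Category.assoc] }
  id_comp f := Hom.ext (Category.id_comp _) (Category.id_comp _) (Category.id_comp _)
  comp_id f := Hom.ext (Category.comp_id _) (Category.comp_id _) (Category.comp_id _)
  assoc f g h := Hom.ext (Category.assoc _ _ _) (Category.assoc _ _ _) (Category.assoc _ _ _)

variable (C) in
/-- The quotient object `B` of a split extension, as an object of `C`. -/
def forgetB : HopfSplitExt C ⥤ C where
  obj S := S.B
  map f := Hom.g f

variable (C) in
/-- The kernel object `X` of a split extension, as an object of `C`. -/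
def forgetX : HopfSplitExt C ⥤ C where
  obj S := S.X
  map f := Hom.v f

end HopfSplitExt

/-! ### Actions of associative Hopf algebras -/

/-- An action of an associative Hopf algebra `B` on an associative Hopf algebra `X` in `C`. -/
structure HopfAction (C : Type*) [Category* C] [MonoidalCategory C] [SymmetricCategory C] where
  /-- the Hopf algebra that acts -/
  B : C
  /-- the Hopf algebra acted upon -/
  X : C
  [hopfB : HopfObj B]
  [hopfX : HopfObj X]
  act : B ⊗ X ⟶ X
  one_act : η[B] ▷ X ≫ act = (λ_ X).hom
  act_one : B ◁ η[X] ≫ act = (ρ_ B).hom ≫ ε[B] ≫ η[X]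
  cocomm : Δ[B] ▷ X ≫ (α_ B B X).hom ≫ B ◁ act =
    Δ[B] ▷ X ≫ (β_ B B).hom ▷ X ≫ (α_ B B X).hom ≫ B ◁ act
  act_counit : act ≫ ε[X] = (ε[B] ⊗ₘ ε[X]) ≫ (λ_ (𝟙_ C)).hom
  act_comul : act ≫ Δ[X] = (Δ[B] ⊗ₘ Δ[X]) ≫ tensorμ B B X X ≫ (act ⊗ₘ act)
  mul_act : μ[B] ▷ X ≫ act = (α_ B B X).hom ≫ B ◁ act ≫ act
  act_mul : B ◁ μ[X] ≫ act = Δ[B] ▷ (X ⊗ X) ≫ tensorμ B B X X ≫ (act ⊗ₘ act) ≫ μ[X]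

namespace HopfAction

attribute [instance] hopfB hopfX

variable {C : Type*} [Category* C] [MonoidalCategory C] [SymmetricCategory C]

/-- Morphisms of actions: pairs of Hopf algebra morphisms compatible with the actions. -/
@[ext]
structure Hom (S T : HopfAction C) where
  g : S.B ⟶ T.B
  v : S.X ⟶ T.X
  [isBimonHom_g : IsBimonHom g]
  [isBimonHom_v : IsBimonHom v]
  act_comm : S.act ≫ v = (g ⊗ₘ v) ≫ T.act

attribute [instance] Hom.isBimonHom_g Hom.isBimonHom_v

/-- The category of actions of associative Hopf algebras in `C`. -/
instance : Category (HopfAction C) where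
  Hom S T := Hom S T
  id S :=
    { g := 𝟙 _, v := 𝟙 _
      isBimonHom_g := HopfSplitExt.isBimonHom_id _
      isBimonHom_v := HopfSplitExt.isBimonHom_id _
      act_comm := by simp }
  comp f h :=
    { g := f.g ≫ h.g, v := f.v ≫ h.v
      isBimonHom_g := HopfSplitExt.isBimonHom_comp _ _
      isBimonHom_v := HopfSplitExt.isBimonHom_comp _ _
      act_comm := by
        rw [← Category.assoc, f.act_comm, Category.assoc, h.act_comm, ← Category.assoc,
          tensorHom_comp_tensorHom] }
  id_comp f := Hom.ext (Category.id_comp _) (Category.id_comp _)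
  comp_id f := Hom.ext (Category.comp_id _) (Category.comp_id _)
  assoc f g h := Hom.ext (Category.assoc _ _ _) (Category.assoc _ _ _)

variable (C) in
/-- The acting Hopf algebra `B`, as an object of `C`. -/
def forgetB : HopfAction C ⥤ C where
  obj S := S.B
  map f := Hom.g f

variable (C) in
/-- The Hopf algebra `X` acted upon, as an object of `C`. -/
def forgetX : HopfAction C ⥤ C where
  obj S := S.X
  map f := Hom.v f

end HopfAction

/-- A functor from split extensions to actions is *canonical* if, up to natural isomorphisms of Hopf
algebras, it sends a split extension `X ⇄ A ⇄ B` to the action `λ · m · (e ⊗ κ)` of `B` on `X`, and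
a morphism `(g, v, p)` to `(g, v)` (this is the naturality of `b` and `x`). -/
def IsCanonicalSplitExtToAction {C : Type*} [Category* C] [MonoidalCategory C]
    [SymmetricCategory C] (F : HopfSplitExt C ⥤ HopfAction C) : Prop :=
  ∃ (b : F ⋙ HopfAction.forgetB C ≅ HopfSplitExt.forgetB C)
    (x : F ⋙ HopfAction.forgetX C ≅ HopfSplitExt.forgetX C),
    ∀ S : HopfSplitExt C,
      IsBimonHom (M := (F.obj S).B) (N := S.B) (b.hom.app S) ∧
      IsBimonHom (M := (F.obj S).X) (N := S.X) (x.hom.app S) ∧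
      (F.obj S).act ≫ x.hom.app S =
        (b.hom.app S ⊗ₘ x.hom.app S) ≫ (S.e ⊗ₘ S.κ) ≫ μ[S.A] ≫ S.ret

/-! ### Split extensions of groups and group actions -/

universe u v w

/-- A split extension of groups: a short exact sequence `1 → X → A → B → 1` of groups with a
homomorphic section `B → A`. -/
structure GroupSplitExt where
  X : Type w
  A : Type w
  B : Type w
  [groupX : Group X]
  [groupA : Group A]
  [groupB : Group B]
  ext : GroupExtension X A B
  splitting : ext.Splitting

namespace GroupSplitExt

attribute [instance] groupX groupA groupB

/-- Morphisms of split extensions of groups: triples of homomorphisms making the diagram commute. -/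
@[ext]
structure Hom (S T : GroupSplitExt.{w}) where
  g : S.B →* T.B
  v : S.X →* T.X
  p : S.A →* T.A
  inl_comm : ∀ x, p (S.ext.inl x) = T.ext.inl (v x)
  splitting_comm : ∀ b, p (S.splitting b) = T.splitting (g b)
  rightHom_comm : ∀ a, g (S.ext.rightHom a) = T.ext.rightHom (p a)

/-- The category of split extensions of groups. -/
instance : Category GroupSplitExt.{w} where
  Hom S T := Hom S T
  id S :=
    { g := MonoidHom.id _, v := MonoidHom.id _, p := MonoidHom.id _
      inl_comm := fun _ => rfl
      splitting_comm := fun _ => rfl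
      rightHom_comm := fun _ => rfl }
  comp f h :=
    { g := h.g.comp f.g, v := h.v.comp f.v, p := h.p.comp f.p
      inl_comm := fun x => by simp [f.inl_comm, h.inl_comm]
      splitting_comm := fun b => by simp [f.splitting_comm, h.splitting_comm]
      rightHom_comm := fun a => by simp [f.rightHom_comm, h.rightHom_comm] }

end GroupSplitExt

/-- An action of a group `B` on a group `X` by group automorphisms. -/
structure GroupAction where
  B : Type w
  X : Type w
  [groupB : Group B]
  [groupX : Group X]
  [action : MulDistribMulAction B X]

namespace GroupAction

attribute [instance] groupB groupX action

/-- Morphisms of group actions: equivariant pairs of homomorphisms. -/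
@[ext]
structure Hom (S T : GroupAction.{w}) where
  g : S.B →* T.B
  v : S.X →* T.X
  smul_comm : ∀ b x, v (b • x) = g b • v x

/-- The category of group actions. -/
instance : Category GroupAction.{w} where
  Hom S T := Hom S T
  id S := { g := MonoidHom.id _, v := MonoidHom.id _, smul_comm := fun _ _ => rfl }
  comp f h :=
    { g := h.g.comp f.g, v := h.v.comp f.v
      smul_comm := fun b x => by simp [f.smul_comm, h.smul_comm] }

end GroupAction

/-- The classical functor from split extensions of groups to group actions: `B` acts on `X` by
conjugation in `A` through the section, `κ (b • x) = e b * κ x * (e b)⁻¹`. -/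
noncomputable def groupSplitExtToAction : GroupSplitExt.{w} ⥤ GroupAction.{w} where
  obj S :=
    { B := S.B
      X := S.X
      action := MulDistribMulAction.compHom S.X
        (S.ext.conjAct.comp (S.splitting : S.B →* S.A)) }
  map {S T} f :=
    { g := f.g
      v := f.v
      smul_comm := fun b x => T.ext.inl_injective (by
        change T.ext.inl (f.v (S.ext.conjAct (S.splitting b) x)) =
          T.ext.inl (T.ext.conjAct (T.splitting (f.g b)) (f.v x))
        rw [← f.inl_comm, GroupExtension.inl_conjAct_comm, GroupExtension.inl_conjAct_comm,
          map_mul, map_mul, map_inv, f.splitting_comm, f.inl_comm]) }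

/-! ### Comparison in the category of sets -/

theorem comul_type_apply (A : Type w) [ComonObj A] (a : A) : Δ[A] a = (a, a) := by
  have h1 := ConcreteCategory.congr_hom (ComonObj.counit_comul A) a
  have h2 := ConcreteCategory.congr_hom (ComonObj.comul_counit A) a
  have e1 : (Δ[A] a : A × A).1 = a := congrArg (fun q : A × PUnit.{w + 1} => q.1) h2
  have e2 : (Δ[A] a : A × A).2 = a := congrArg (fun q : PUnit.{w + 1} × A => q.2) h1
  exact Prod.ext e1 e2

/-- An associative Hopf algebra in the category of sets is a group: the product and the unit are
the structure maps `μ` and `η`, and the inverse is the antipode. -/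
abbrev hopfGroup (A : Type w) [HopfObj A] : Group A :=
  { MonTypeEquivalenceMon.monMonoid A with
    inv := fun a => HopfObj.antipode (X := A) a
    inv_mul_cancel := fun a => by
      have h := ConcreteCategory.congr_hom (HopfObj.antipode_left A) a
      have h2 := congrArg (fun q : A × A =>
        (μ[A] : A ⊗ A ⟶ A) ((HopfObj.antipode (X := A) q.1, q.2) : A × A)) (comul_type_apply A a)
      exact h2.symm.trans h }

/-- A morphism of associative Hopf algebras in the category of sets is a group homomorphism. -/
abbrev hopfGroupHom {A B : Type w} [HopfObj A] [HopfObj B] (f : A ⟶ B) [IsBimonHom f] :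
    letI := hopfGroup A
    letI := hopfGroup B
    A →* B :=
  letI := hopfGroup A
  letI := hopfGroup B
  { toFun := f
    map_one' := ConcreteCategory.congr_hom (IsMonHom.one_hom f) PUnit.unit
    map_mul' := fun x y =>
      ConcreteCategory.congr_hom (CC := fun X ↦ X) (IsMonHom.mul_hom f) (x, y) }

/-- A split extension of associative Hopf algebras in the category of sets is a split extension of
groups. -/
noncomputable def setSplitExtToGroup : HopfSplitExt (Type w) ⥤ GroupSplitExt.{w} where
  obj S :=
    letI := hopfGroup S.X
    letI := hopfGroup S.A
    letI := hopfGroup S.B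
    { X := S.X
      A := S.A
      B := S.B
      ext :=
        { inl := hopfGroupHom S.κ
          rightHom := hopfGroupHom S.α
          inl_injective := Function.LeftInverse.injective
            (g := fun a => S.ret a) (fun x => ConcreteCategory.congr_hom S.κ_ret x)
          range_inl_eq_ker_rightHom := by
            ext a
            constructor
            · rintro ⟨x, rfl⟩
              exact ConcreteCategory.congr_hom S.κ_α x
            · intro ha
              refine ⟨S.ret a, ?_⟩
              have hd : S.κ (S.ret a) * S.e (S.α a) = a := by
                have h := ConcreteCategory.congr_hom S.decomp a
                have h2 := congrArg (fun q : S.A × S.A =>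
                  S.κ (S.ret q.1) * S.e (S.α q.2)) (comul_type_apply S.A a)
                exact h2.symm.trans h
              have ha' : S.α a = (1 : S.B) := ha
              have he : S.e (1 : S.B) = (1 : S.A) := (hopfGroupHom S.e).map_one
              rw [ha', he, mul_one] at hd
              exact hd
          rightHom_surjective := Function.RightInverse.surjective
            (g := fun b => S.e b) (fun b => ConcreteCategory.congr_hom S.e_α b) }
      splitting :=
        { hopfGroupHom S.e with
          rightInverse_rightHom := fun b => ConcreteCategory.congr_hom S.e_α b } }
  map f :=
    { g := hopfGroupHom (HopfSplitExt.Hom.g f)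
      v := hopfGroupHom (HopfSplitExt.Hom.v f)
      p := hopfGroupHom (HopfSplitExt.Hom.p f)
      inl_comm := fun x => ConcreteCategory.congr_hom (HopfSplitExt.Hom.κ_comm f) x
      splitting_comm := fun b => ConcreteCategory.congr_hom (HopfSplitExt.Hom.e_comm f) b
      rightHom_comm := fun a => ConcreteCategory.congr_hom (HopfSplitExt.Hom.α_comm f) a }

/-- An action of associative Hopf algebras in the category of sets is a group action. -/
noncomputable def setActionToGroup : HopfAction (Type w) ⥤ GroupAction.{w} where
  obj S :=
    letI := hopfGroup S.B
    letI := hopfGroup S.X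
    { B := S.B
      X := S.X
      action :=
        { smul := fun b x => S.act ((b, x) : S.B × S.X)
          one_smul := fun x =>
            ConcreteCategory.congr_hom S.one_act ((PUnit.unit, x) : PUnit.{w + 1} × S.X)
          mul_smul := fun b c x =>
            ConcreteCategory.congr_hom S.mul_act (((b, c), x) : (S.B × S.B) × S.X)
          smul_mul := fun b x y => by
            have h := ConcreteCategory.congr_hom S.act_mul ((b, (x, y)) : S.B × (S.X × S.X))
            have h2 := congrArg (fun q : S.B × S.B =>
              (S.act ((q.1, x) : S.B × S.X) * S.act ((q.2, y) : S.B × S.X) : S.X))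
              (comul_type_apply S.B b)
            exact h.trans h2
          smul_one := fun b =>
            ConcreteCategory.congr_hom S.act_one ((b, PUnit.unit) : S.B × PUnit.{w + 1}) } }
  map f :=
    { g := hopfGroupHom (HopfAction.Hom.g f)
      v := hopfGroupHom (HopfAction.Hom.v f)
      smul_comm := fun b x =>
        ConcreteCategory.congr_hom (HopfAction.Hom.act_comm f) ((b, x) : _ × _) }

/-!
The argument treats Hopf algebras through their underlying comonoids. In a symmetric monoidal
category the comonoids form a semicartesian category: `X ⊗ Y` has projections `Comonoid.fst` and
`Comonoid.snd`, and although it is not a product, two comonoid morphisms into it agree as soon as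
they agree after both projections (`Comonoid.hom_ext`). The pairing `⟨f, g⟩ = Δ ≫ (f ⊗ g)` is a
comonoid morphism when it is unchanged, up to the braiding, by exchanging `f` and `g`
(`Comonoid.isComonHom_pair`). The cocommutativity axiom of an action `▷ : B ⊗ X ⟶ X` says exactly
this for `swap = ⟨▷, fst⟩ : B ⊗ X ⟶ X ⊗ B`, in elements `b ⊗ x ↦ (b₁ ▷ x) ⊗ b₂`. Hence `swap`
is a comonoid morphism, and every identity between morphisms built from it can be checked on the
two projections.

From actions to split extensions: the action axioms say, on the two projections, that `swap` is a
distributive law between the monoids `X` and `B`. A distributive law makes `X ⊗ B` a monoid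
(`DistributiveLaw.mul_assoc`), and its multiplication is again a comonoid morphism, so `X ⊗ B` is a
bialgebra. The identity of `X ⊗ B` is the convolution product of `fst ≫ inl` and `snd ≫ inr`, each
of which is invertible because `X` and `B` have antipodes; the inverse of the product is the
antipode of `X ⊗ B`. With the evident injections and projections this is the split extension
`HopfAction.toSplitExt`, whose action is the given one.

From split extensions to actions: `factor = m (κ ⊗ e) : X ⊗ B ⟶ A` is an isomorphism with inverse
`⟨λ, α⟩`. Under it, `m (e ⊗ κ)` becomes the `swap` of the candidate action `λ m (e ⊗ κ)`
(`HopfSplitExt.tensorHom_mul_eq_swap`), so associativity in `A` rewrites products of the shapes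
`b b' x` and `b x x'` with the factor from `X` in front, and applying `λ` yields the action axioms.
The same rule describes the whole multiplication of `A` through `factor`
(`tensorHom_mul_of_swap`). Therefore a morphism of split extensions is determined by its components
on `B` and `X`, and any pair compatible with the actions extends to `A`
(`HopfSplitExt.isBimonHom_lift`): the functor to actions is fully faithful, and essentially
surjective by the previous paragraph.

In the category of sets every comonoid is diagonal, so Hopf algebras are groups and actions of Hopf
algebras are group actions. For groups, conjugation gives an equivalence by the semidirect product,
and `κ (λ (e b * κ x)) = e b * κ x * (e b)⁻¹` identifies the two functors to group actions
(`HopfSplitExt.act_eq_conjAct`). Forgetting `λ` is then an equivalence because the other three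
sides of the square are.
-/

/-! ### Projections and pairings for comonoids -/

namespace Comonoid

section

variable {C : Type u} [Category.{v} C] [MonoidalCategory C]

/-- The projection `X ⊗ Y ⟶ X` given by the counit of `Y`; no structure on `X` is needed. -/
def fst (X Y : C) [ComonObj Y] : X ⊗ Y ⟶ X := X ◁ ε[Y] ≫ (ρ_ X).hom

/-- The projection `X ⊗ Y ⟶ Y` given by the counit of `X`; no structure on `Y` is needed. -/
def snd (X Y : C) [ComonObj X] : X ⊗ Y ⟶ Y := ε[X] ▷ Y ≫ (λ_ Y).hom

/-- The pairing `⟨f, g⟩` of two morphisms out of a comonoid, `t ↦ f t₁ ⊗ g t₂`. It is defined for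
arbitrary morphisms of `C` and is not a comonoid morphism in general. -/
def pair {T X Y : C} [ComonObj T] (f : T ⟶ X) (g : T ⟶ Y) : T ⟶ X ⊗ Y :=
  Δ[T] ≫ (f ⊗ₘ g)

section

variable {T U X Y Z W : C} [ComonObj T] [ComonObj U]

theorem tensorHom_fst [ComonObj Y] [ComonObj W] (f : X ⟶ Z) (g : Y ⟶ W) [IsComonHom g] :
    (f ⊗ₘ g) ≫ fst Z W = fst X Y ≫ f := by
  rw [fst, MonoidalCategory.tensorHom_def, Category.assoc, ← whiskerLeft_comp_assoc,
    IsComonHom.hom_counit, ← whisker_exchange_assoc]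
  simp [fst]

theorem tensorHom_snd [ComonObj X] [ComonObj Z] (f : X ⟶ Z) (g : Y ⟶ W) [IsComonHom f] :
    (f ⊗ₘ g) ≫ snd Z W = snd X Y ≫ g := by
  rw [snd, MonoidalCategory.tensorHom_def', Category.assoc, ← comp_whiskerRight_assoc,
    IsComonHom.hom_counit, whisker_exchange_assoc]
  simp [snd]

theorem pair_fst [ComonObj Y] (f : T ⟶ X) (g : T ⟶ Y) [IsComonHom g] :
    pair f g ≫ fst X Y = f := by
  rw [pair, Category.assoc, tensorHom_fst]
  simp [fst]

theorem pair_snd [ComonObj X] (f : T ⟶ X) (g : T ⟶ Y) [IsComonHom f] :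
    pair f g ≫ snd X Y = g := by
  rw [pair, Category.assoc, tensorHom_snd]
  simp [snd]

theorem comp_pair (h : U ⟶ T) [IsComonHom h] (f : T ⟶ X) (g : T ⟶ Y) :
    h ≫ pair f g = pair (h ≫ f) (h ≫ g) := by
  simp [pair]

theorem pair_tensorHom (f : T ⟶ X) (g : T ⟶ Y) (h : X ⟶ Z) (k : Y ⟶ W) :
    pair f g ≫ (h ⊗ₘ k) = pair (f ≫ h) (g ≫ k) := by
  simp [pair]

end

/-- The fourfold comultiplication, bracketed so that the two middle factors come from one
comultiplication: `(t₁ ⊗ t₂) ⊗ (t₃ ⊗ t₄)` with `t₂ ⊗ t₃` obtained by applying `Δ` last. -/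
theorem comul_comp_tensorHom_comul (T : C) [ComonObj T] :
    Δ[T] ≫ (Δ[T] ⊗ₘ Δ[T]) =
      Δ[T] ≫ T ◁ (Δ[T] ≫ Δ[T] ▷ T) ≫ T ◁ (α_ T T T).hom ≫ (α_ T T (T ⊗ T)).inv := by
  rw [MonoidalCategory.tensorHom_def, ComonObj.comul_assoc_flip_assoc]
  rw [MonoidalCategory.tensor_whiskerLeft, Iso.inv_hom_id_assoc,
    ← MonoidalCategory.whiskerLeft_comp_assoc, ComonObj.comul_assoc]
  simp only [MonoidalCategory.whiskerLeft_comp, Category.assoc]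

theorem whiskerLeft_fst (X : C) {Y Z : C} [ComonObj Y] [ComonObj Z] (f : Y ⟶ Z) [IsComonHom f] :
    X ◁ f ≫ fst X Z = fst X Y := by
  rw [← id_tensorHom, tensorHom_fst, Category.comp_id]

theorem whiskerRight_fst {X Y : C} (f : X ⟶ Y) (Z : C) [ComonObj Z] :
    f ▷ Z ≫ fst Y Z = fst X Z ≫ f := by
  rw [← tensorHom_id, tensorHom_fst]

theorem whiskerLeft_snd (X : C) [ComonObj X] {Y Z : C} (f : Y ⟶ Z) :
    X ◁ f ≫ snd X Z = snd X Y ≫ f := by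
  rw [← id_tensorHom, tensorHom_snd]

theorem whiskerRight_snd {X Y : C} [ComonObj X] [ComonObj Y] (f : X ⟶ Y) [IsComonHom f] (Z : C) :
    f ▷ Z ≫ snd Y Z = snd X Z := by
  rw [← tensorHom_id, tensorHom_snd, Category.comp_id]

theorem associator_hom_whiskerLeft_snd (X Y Z : C) [ComonObj Y] :
    (α_ X Y Z).hom ≫ X ◁ snd Y Z = fst X Y ▷ Z := by
  simp [fst, snd]

theorem associator_hom_snd_whiskerRight (X Y Z : C) [ComonObj X] :
    (α_ X Y Z).hom ≫ snd X (Y ⊗ Z) = snd X Y ▷ Z := by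
  simp [snd]

theorem associator_hom_whiskerLeft_fst (X Y Z : C) [ComonObj Z] :
    (α_ X Y Z).hom ≫ X ◁ fst Y Z = fst (X ⊗ Y) Z := by
  simp [fst]

theorem associator_inv_fst (X Y Z : C) [ComonObj Z] :
    (α_ X Y Z).inv ≫ fst (X ⊗ Y) Z = X ◁ fst Y Z := by
  rw [← associator_hom_whiskerLeft_fst, Iso.inv_hom_id_assoc]

/-- The morphism `x ↦ x ⊗ 1`. -/
def inl (X M : C) [MonObj M] : X ⟶ X ⊗ M := (ρ_ X).inv ≫ X ◁ η[M]

/-- The morphism `x ↦ 1 ⊗ x`. -/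
def inr (M X : C) [MonObj M] : X ⟶ M ⊗ X := (λ_ X).inv ≫ η[M] ▷ X

theorem inl_eq_pair (X M : C) [ComonObj X] [MonObj M] : inl X M = pair (𝟙 X) (ε[X] ≫ η[M]) := by
  simp [inl, pair]

theorem inr_eq_pair (M X : C) [ComonObj X] [MonObj M] : inr M X = pair (ε[X] ≫ η[M]) (𝟙 X) := by
  simp [inr, pair]

theorem counit_one_tensorHom_mul {X Y M : C} [ComonObj X] [MonObj M] (f : Y ⟶ M) :
    (ε[X] ≫ η[M] ⊗ₘ f) ≫ μ[M] = snd X Y ≫ f := by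
  rw [MonoidalCategory.tensorHom_def', comp_whiskerRight, Category.assoc, Category.assoc,
    MonObj.one_mul, snd, whisker_exchange_assoc, leftUnitor_naturality, Category.assoc]

theorem tensorHom_counit_one_mul {X Y M : C} [ComonObj Y] [MonObj M] (f : X ⟶ M) :
    (f ⊗ₘ ε[Y] ≫ η[M]) ≫ μ[M] = fst X Y ≫ f := by
  rw [MonoidalCategory.tensorHom_def, MonoidalCategory.whiskerLeft_comp, Category.assoc,
    Category.assoc, MonObj.mul_one, fst, ← whisker_exchange_assoc, rightUnitor_naturality,
    Category.assoc]

theorem pair_counit_one_mul {U M : C} [ComonObj U] [MonObj M] (f : U ⟶ M) :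
    pair f (ε[U] ≫ η[M]) ≫ μ[M] = f := by
  rw [pair, Category.assoc, tensorHom_counit_one_mul]
  simp [fst]

theorem pair_one_counit_mul {U M : C} [ComonObj U] [MonObj M] (f : U ⟶ M) :
    pair (ε[U] ≫ η[M]) f ≫ μ[M] = f := by
  rw [pair, Category.assoc, counit_one_tensorHom_mul]
  simp [snd]

end

/-! ### Comonoid morphisms into a tensor product -/

variable {C : Type u} [Category.{v} C] [MonoidalCategory C] [BraidedCategory C]

instance isComonHom_tensorHom {M N P Q : C} [ComonObj M] [ComonObj N] [ComonObj P] [ComonObj Q]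
    (f : M ⟶ N) (g : P ⟶ Q) [IsComonHom f] [IsComonHom g] : IsComonHom (f ⊗ₘ g) where
  hom_counit := by simp
  hom_comul := by
    simp only [Comon.tensorObj_comul, tensorHom_comp_tensorHom_assoc, IsComonHom.hom_comul,
      Category.assoc]
    rw [← tensorHom_comp_tensorHom_assoc, tensorμ_natural]

instance isComonHom_whiskerLeft {M N : C} (P : C) [ComonObj M] [ComonObj N] [ComonObj P]
    (f : M ⟶ N) [IsComonHom f] : IsComonHom (P ◁ f) := by
  rw [← id_tensorHom]; infer_instance

instance isComonHom_whiskerRight {M N : C} (P : C) [ComonObj M] [ComonObj N] [ComonObj P]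
    (f : M ⟶ N) [IsComonHom f] : IsComonHom (f ▷ P) := by
  rw [← tensorHom_id]; infer_instance

instance isComonHom_associator (M N P : C) [ComonObj M] [ComonObj N] [ComonObj P] :
    IsComonHom (α_ M N P).hom := by
  -- The associator of the monoidal category `Comon C` is a bundled comonoid morphism.
  have h := (α_ (Comon.mk M) (Comon.mk N) (Comon.mk P)).hom.isComonHom_hom
  have h' : (α_ (Comon.mk M) (Comon.mk N) (Comon.mk P)).hom.hom = (α_ M N P).hom := by
    rw [Comon.monoidal_associator_hom_hom]
    erw [id_whiskerRight, MonoidalCategory.whiskerLeft_id, Category.id_comp, Category.comp_id]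
  rwa [h'] at h

instance isComonHom_associator_inv (M N P : C) [ComonObj M] [ComonObj N] [ComonObj P] :
    IsComonHom (α_ M N P).inv :=
  inferInstanceAs (IsComonHom (α_ M N P).inv)

instance isComonHom_fst (X Y : C) [ComonObj X] [ComonObj Y] : IsComonHom (fst X Y) := by
  -- The unit object is terminal in `Comon C`, with the counit as the morphism to it.
  have h := (Comon.mk X ◁ (default : Comon.mk Y ⟶ Comon.trivial C) ≫
    (ρ_ (Comon.mk X)).hom).isComonHom_hom
  have h' : (Comon.mk X ◁ (default : Comon.mk Y ⟶ Comon.trivial C) ≫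
      (ρ_ (Comon.mk X)).hom).hom = fst X Y := by
    erw [Comon.comp_hom', Comon.monoidal_rightUnitor_hom_hom, Comon.monoidal_whiskerLeft_hom]
    erw [MonoidalCategory.whiskerLeft_id, Category.id_comp]
    rfl
  rwa [h'] at h

instance isComonHom_snd (X Y : C) [ComonObj X] [ComonObj Y] : IsComonHom (snd X Y) := by
  have h := ((default : Comon.mk X ⟶ Comon.trivial C) ▷ Comon.mk Y ≫
    (λ_ (Comon.mk Y)).hom).isComonHom_hom
  have h' : ((default : Comon.mk X ⟶ Comon.trivial C) ▷ Comon.mk Y ≫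
      (λ_ (Comon.mk Y)).hom).hom = snd X Y := by
    erw [Comon.comp_hom', Comon.monoidal_leftUnitor_hom_hom, Comon.monoidal_whiskerRight_hom]
    erw [id_whiskerRight, Category.id_comp]
    rfl
  rwa [h'] at h

section

variable {T X Y : C} [ComonObj T]

theorem pair_fst_snd (X Y : C) [ComonObj X] [ComonObj Y] :
    pair (fst X Y) (snd X Y) = 𝟙 (X ⊗ Y) := by
  have h : (X ◁ ε[Y] ⊗ₘ ε[X] ▷ Y) = ((𝟙 X ⊗ₘ ε[Y]) ⊗ₘ (ε[X] ⊗ₘ 𝟙 Y)) := by simp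
  simp only [pair, fst, snd, Comon.tensorObj_comul, Category.assoc, ← tensorHom_comp_tensorHom]
  rw [h, ← tensorμ_natural_assoc, tensorHom_comp_tensorHom_assoc, id_tensorHom, tensorHom_id,
    ComonObj.comul_counit, ComonObj.counit_comul]
  simp only [tensorμ, braiding_tensorUnit_left]
  monoidal

/-- The projections out of `X ⊗ Y` are jointly monic on comonoid morphisms, since `⟨fst, snd⟩`
is the identity and pairing commutes with precomposition by comonoid morphisms. -/
theorem hom_ext [ComonObj X] [ComonObj Y] {f g : T ⟶ X ⊗ Y} [IsComonHom f] [IsComonHom g]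
    (h₁ : f ≫ fst X Y = g ≫ fst X Y) (h₂ : f ≫ snd X Y = g ≫ snd X Y) : f = g := by
  rw [← Category.comp_id f, ← Category.comp_id g, ← pair_fst_snd, comp_pair, comp_pair, h₁, h₂]

/-- If the pairing of two comonoid morphisms is symmetric under the braiding, it is a comonoid
morphism: comultiplying `f t₁ ⊗ g t₂` exchanges the two middle factors of
`f t₁ ⊗ f t₂ ⊗ g t₃ ⊗ g t₄`, which the symmetry, applied to `t₂` and `t₃`, undoes. -/
theorem isComonHom_pair [ComonObj X] [ComonObj Y] (f : T ⟶ X) (g : T ⟶ Y)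
    [IsComonHom f] [IsComonHom g] (h : pair f g ≫ (β_ X Y).hom = pair g f) :
    IsComonHom (pair f g) where
  hom_counit := by simp [pair, unitors_equal]
  hom_comul := by
    have h' : Δ[T] ≫ (g ⊗ₘ f) = (Δ[T] ≫ (f ⊗ₘ g)) ≫ (β_ X Y).hom := h.symm
    simp only [pair, Category.assoc, Comon.tensorObj_comul, tensorHom_comp_tensorHom_assoc,
      IsComonHom.hom_comul]
    rw [← tensorHom_comp_tensorHom_assoc, ← tensorHom_comp_tensorHom]
    rw [reassoc_of% comul_comp_tensorHom_comul T, reassoc_of% comul_comp_tensorHom_comul T]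
    -- Both sides are brought to the form where `f` or `g` act on the innermost comultiplication.
    have e₁ : T ◁ (α_ T T T).hom ≫ (α_ T T (T ⊗ T)).inv ≫ ((f ⊗ₘ f) ⊗ₘ g ⊗ₘ g) ≫
        tensorμ X X Y Y = T ◁ ((f ⊗ₘ g) ▷ T) ≫ T ◁ ((β_ X Y).hom ▷ T) ≫
        (f ⊗ₘ ((𝟙 _) ⊗ₘ g)) ≫ X ◁ (α_ Y X Y).hom ≫ (α_ X Y (X ⊗ Y)).inv := by
      rw [tensorμ, associator_naturality_assoc, Iso.inv_hom_id_assoc]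
      simp only [← id_tensorHom, ← tensorHom_id, tensorHom_comp_tensorHom_assoc,
        Category.id_comp, Category.comp_id]
      rw [← associator_naturality_assoc, Iso.hom_inv_id_assoc, tensorHom_comp_tensorHom_assoc,
        Category.comp_id]
    have e₂ : T ◁ (α_ T T T).hom ≫ (α_ T T (T ⊗ T)).inv ≫ ((f ⊗ₘ g) ⊗ₘ f ⊗ₘ g) =
        T ◁ ((g ⊗ₘ f) ▷ T) ≫
        (f ⊗ₘ ((𝟙 _) ⊗ₘ g)) ≫ X ◁ (α_ Y X Y).hom ≫ (α_ X Y (X ⊗ Y)).inv := by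
      rw [← associator_inv_naturality]
      simp only [← id_tensorHom, ← tensorHom_id, tensorHom_comp_tensorHom_assoc,
        Category.id_comp, Category.comp_id]
      rw [associator_naturality]
    rw [e₁, e₂, ← whiskerLeft_comp_assoc, ← whiskerLeft_comp_assoc, ← whiskerLeft_comp_assoc]
    simp only [Category.assoc, ← comp_whiskerRight]
    rw [h']
    simp only [Category.assoc]

end

end Comonoid

/-! ### Distributive laws between monoids -/

/-- A distributive law between monoids `X` and `B` in a monoidal category, which need not be
braided: a morphism `B ⊗ X ⟶ X ⊗ B` compatible with both units and both multiplications. -/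
structure DistributiveLaw {C : Type u} [Category.{v} C] [MonoidalCategory C] (X B : C)
    [MonObj X] [MonObj B] where
  /-- the rule that moves an element of `B` past an element of `X` -/
  swap : B ⊗ X ⟶ X ⊗ B
  one_left : η[B] ▷ X ≫ swap = (λ_ X).hom ≫ (ρ_ X).inv ≫ X ◁ η[B]
  one_right : B ◁ η[X] ≫ swap = (ρ_ B).hom ≫ (λ_ B).inv ≫ η[X] ▷ B
  mul_left : μ[B] ▷ X ≫ swap =
    (α_ B B X).hom ≫ B ◁ swap ≫ (α_ B X B).inv ≫ swap ▷ B ≫ (α_ X B B).hom ≫ X ◁ μ[B]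
  mul_right : B ◁ μ[X] ≫ swap =
    (α_ B X X).inv ≫ swap ▷ X ≫ (α_ X B X).hom ≫ X ◁ swap ≫ (α_ X X B).inv ≫ μ[X] ▷ B

namespace DistributiveLaw

variable {C : Type u} [Category.{v} C] [MonoidalCategory C] {X B : C} [MonObj X] [MonObj B]
  (D : DistributiveLaw X B)

/-- The multiplication on `X ⊗ B`: exchange the two middle factors by the distributive law, then
multiply in `X` and in `B`. -/
def mul : (X ⊗ B) ⊗ (X ⊗ B) ⟶ X ⊗ B :=
  (α_ X B (X ⊗ B)).hom ≫ X ◁ ((α_ B X B).inv ≫ D.swap ▷ B ≫ (α_ X B B).hom) ≫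
    (α_ X X (B ⊗ B)).inv ≫ (μ[X] ⊗ₘ μ[B])

/-- The multiplication on `X ⊗ B`, with the product in `X` formed before the one in `B`. -/
theorem mul_eq : D.mul = 𝟙 _ ⊗≫ X ◁ D.swap ▷ B ⊗≫ μ[X] ▷ (B ⊗ B) ⊗≫ X ◁ μ[B] ⊗≫ 𝟙 _ := by
  rw [mul, MonoidalCategory.tensorHom_def]
  monoidal

/-- The multiplication on `X ⊗ B`, with the product in `B` formed before the one in `X`. -/
theorem mul_eq' : D.mul = 𝟙 _ ⊗≫ X ◁ D.swap ▷ B ⊗≫ (X ⊗ X) ◁ μ[B] ⊗≫ μ[X] ▷ B ⊗≫ 𝟙 _ := by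
  rw [mul, MonoidalCategory.tensorHom_def']
  monoidal

theorem one_mul :
    ((λ_ (𝟙_ C)).inv ≫ (η[X] ⊗ₘ η[B])) ▷ (X ⊗ B) ≫ D.mul = (λ_ (X ⊗ B)).hom := by
  rw [mul_eq, MonoidalCategory.tensorHom_def]
  calc
    _ = 𝟙 _ ⊗≫ η[X] ▷ (X ⊗ B) ⊗≫ X ◁ (η[B] ▷ X ≫ D.swap) ▷ B ⊗≫ μ[X] ▷ (B ⊗ B) ⊗≫
        X ◁ μ[B] ⊗≫ 𝟙 _ := by monoidal
    _ = 𝟙 _ ⊗≫ (η[X] ▷ X ▷ B) ⊗≫ ((X ⊗ X) ◁ η[B] ▷ B ≫ μ[X] ▷ (B ⊗ B)) ⊗≫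
        X ◁ μ[B] ⊗≫ 𝟙 _ := by rw [D.one_left]; monoidal
    _ = 𝟙 _ ⊗≫ (η[X] ▷ X ≫ μ[X]) ▷ B ⊗≫ X ◁ (η[B] ▷ B ≫ μ[B]) ⊗≫ 𝟙 _ := by
        rw [whisker_exchange]; monoidal
    _ = _ := by rw [MonObj.one_mul, MonObj.one_mul]; monoidal

theorem mul_one :
    (X ⊗ B) ◁ ((λ_ (𝟙_ C)).inv ≫ (η[X] ⊗ₘ η[B])) ≫ D.mul = (ρ_ (X ⊗ B)).hom := by
  rw [mul_eq', MonoidalCategory.tensorHom_def']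
  calc
    _ = 𝟙 _ ⊗≫ (X ⊗ B) ◁ η[B] ⊗≫ X ◁ (B ◁ η[X] ≫ D.swap) ▷ B ⊗≫ (X ⊗ X) ◁ μ[B] ⊗≫
        μ[X] ▷ B ⊗≫ 𝟙 _ := by monoidal
    _ = 𝟙 _ ⊗≫ (X ◁ B ◁ η[B]) ⊗≫ (X ◁ η[X] ▷ (B ⊗ B) ≫ X ◁ X ◁ μ[B]) ⊗≫
        μ[X] ▷ B ⊗≫ 𝟙 _ := by rw [D.one_right]; monoidal
    _ = 𝟙 _ ⊗≫ X ◁ (B ◁ η[B] ≫ μ[B]) ⊗≫ (X ◁ η[X] ≫ μ[X]) ▷ B ⊗≫ 𝟙 _ := by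
        rw [← MonoidalCategory.whiskerLeft_comp, ← whisker_exchange]; monoidal
    _ = _ := by rw [MonObj.mul_one, MonObj.mul_one]; monoidal

/-- Associativity of `(x b) (x' b') (x'' b'')`: `mul_left` moves the product `b b'` past `x''` one
factor at a time, and `mul_right` moves `b` past the product of `x'` with the `X`-part of `b' x''`.
On both sides this leaves the same three exchanges, followed by triple products in `X` and `B`. -/
theorem mul_assoc :
    D.mul ▷ (X ⊗ B) ≫ D.mul =
      (α_ (X ⊗ B) (X ⊗ B) (X ⊗ B)).hom ≫ (X ⊗ B) ◁ D.mul ≫ D.mul := by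
  calc
    _ = 𝟙 _ ⊗≫ X ◁ D.swap ▷ B ▷ X ▷ B ⊗≫ μ[X] ▷ (B ⊗ B ⊗ X ⊗ B) ⊗≫
          X ◁ (μ[B] ▷ X ≫ D.swap) ▷ B ⊗≫ μ[X] ▷ (B ⊗ B) ⊗≫ X ◁ μ[B] ⊗≫ 𝟙 _ := by
        rw [mul_eq]; monoidal
    _ = 𝟙 _ ⊗≫ X ◁ D.swap ▷ B ▷ X ▷ B ⊗≫ (μ[X] ▷ ((B ⊗ B ⊗ X) ⊗ B) ≫
          X ◁ (B ◁ D.swap ≫ (α_ B X B).inv ≫ D.swap ▷ B ≫ (α_ X B B).hom ≫ X ◁ μ[B]) ▷ B) ⊗≫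
          μ[X] ▷ (B ⊗ B) ⊗≫ X ◁ μ[B] ⊗≫ 𝟙 _ := by
        rw [D.mul_left]; monoidal
    _ = 𝟙 _ ⊗≫ X ◁ (D.swap ▷ (B ⊗ X) ⊗≫ X ◁ B ◁ D.swap ⊗≫ X ◁ D.swap ▷ B) ▷ B ⊗≫
          ((X ⊗ X) ⊗ X) ◁ μ[B] ▷ B ⊗≫ μ[X] ▷ (X ⊗ B ⊗ B) ⊗≫
          μ[X] ▷ (B ⊗ B) ⊗≫ X ◁ μ[B] ⊗≫ 𝟙 _ := by
        rw [← whisker_exchange μ[X]]; monoidal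
    _ = 𝟙 _ ⊗≫ X ◁ (D.swap ▷ (B ⊗ X) ≫ (X ⊗ B) ◁ D.swap) ▷ B ⊗≫ X ◁ X ◁ D.swap ▷ B ▷ B ⊗≫
          (((X ⊗ X) ⊗ X) ◁ (μ[B] ▷ B) ≫ (μ[X] ▷ X ≫ μ[X]) ▷ (B ⊗ B)) ⊗≫
          X ◁ μ[B] ⊗≫ 𝟙 _ := by
        monoidal
    _ = 𝟙 _ ⊗≫ X ◁ (B ◁ X ◁ D.swap ⊗≫ D.swap ▷ (X ⊗ B) ⊗≫ X ◁ D.swap ▷ B) ▷ B ⊗≫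
          (μ[X] ▷ X ≫ μ[X]) ▷ (B ⊗ B ⊗ B) ⊗≫ X ◁ (μ[B] ▷ B ≫ μ[B]) ⊗≫ 𝟙 _ := by
        rw [← whisker_exchange D.swap D.swap, whisker_exchange (μ[X] ▷ X ≫ μ[X]) (μ[B] ▷ B)]
        monoidal
    _ = 𝟙 _ ⊗≫ X ◁ (B ◁ X ◁ D.swap ⊗≫ D.swap ▷ (X ⊗ B) ⊗≫ X ◁ D.swap ▷ B) ▷ B ⊗≫
          (X ◁ μ[X] ≫ μ[X]) ▷ (B ⊗ B ⊗ B) ⊗≫ X ◁ (B ◁ μ[B] ≫ μ[B]) ⊗≫ 𝟙 _ := by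
        rw [MonObj.mul_assoc, MonObj.mul_assoc]; monoidal
    _ = 𝟙 _ ⊗≫ X ◁ B ◁ X ◁ D.swap ▷ B ⊗≫ X ◁ D.swap ▷ (X ⊗ B ⊗ B) ⊗≫
          X ◁ X ◁ D.swap ▷ (B ⊗ B) ⊗≫ X ◁ μ[X] ▷ (B ⊗ B ⊗ B) ⊗≫ (μ[X] ▷ (B ⊗ (B ⊗ B)) ≫
          X ◁ (B ◁ μ[B])) ⊗≫ X ◁ μ[B] ⊗≫ 𝟙 _ := by
        monoidal
    _ = 𝟙 _ ⊗≫ X ◁ B ◁ X ◁ D.swap ▷ B ⊗≫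
          X ◁ (((α_ B X X).inv ≫ D.swap ▷ X ≫ (α_ X B X).hom ≫ X ◁ D.swap ≫ (α_ X X B).inv ≫
            μ[X] ▷ B) ▷ (B ⊗ B) ≫ (X ⊗ B) ◁ μ[B]) ⊗≫
          μ[X] ▷ (B ⊗ B) ⊗≫ X ◁ μ[B] ⊗≫ 𝟙 _ := by
        rw [← whisker_exchange μ[X] (B ◁ μ[B])]; monoidal
    _ = 𝟙 _ ⊗≫ X ◁ B ◁ X ◁ D.swap ▷ B ⊗≫ X ◁ B ◁ (X ⊗ X) ◁ μ[B] ⊗≫ X ◁ B ◁ μ[X] ▷ B ⊗≫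
          X ◁ D.swap ▷ B ⊗≫ μ[X] ▷ (B ⊗ B) ⊗≫ X ◁ μ[B] ⊗≫ 𝟙 _ := by
        rw [← D.mul_right, ← whisker_exchange (B ◁ μ[X] ≫ D.swap)]; monoidal
    _ = _ := by
        nth_rw 1 [mul_eq']
        rw [mul_eq]; monoidal

end DistributiveLaw

/-! ### Pairings with a projection -/

namespace Comonoid

variable {C : Type u} [Category.{v} C] [MonoidalCategory C] [BraidedCategory C]

theorem associator_hom_fst (X Y Z : C) [ComonObj Y] [ComonObj Z] :
    (α_ X Y Z).hom ≫ fst X (Y ⊗ Z) = fst (X ⊗ Y) Z ≫ fst X Y := by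
  simp [fst, MonoidalCategory.tensorHom_def']

theorem associator_hom_snd (X Y Z : C) [ComonObj X] [ComonObj Y] :
    (α_ X Y Z).hom ≫ snd X (Y ⊗ Z) ≫ snd Y Z = snd (X ⊗ Y) Z := by
  simp [snd, MonoidalCategory.tensorHom_def]

theorem associator_inv_snd (X Y Z : C) [ComonObj X] [ComonObj Y] :
    (α_ X Y Z).inv ≫ snd (X ⊗ Y) Z = snd X (Y ⊗ Z) ≫ snd Y Z := by
  rw [← associator_hom_snd, Iso.inv_hom_id_assoc]

/-- Pairing with the first projection duplicates `B` only: the copy of `X` is discarded by the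
counit. -/
theorem pair_fst_id (B X : C) [ComonObj B] [ComonObj X] :
    pair (fst B X) (𝟙 (B ⊗ X)) = Δ[B] ▷ X ≫ (α_ B B X).hom := by
  have h : (B ◁ ε[X] ⊗ₘ 𝟙 (B ⊗ X)) = ((𝟙 B ⊗ₘ ε[X]) ⊗ₘ (𝟙 B ⊗ₘ 𝟙 X)) := by simp
  have h' : (fst B X ⊗ₘ 𝟙 (B ⊗ X)) = (B ◁ ε[X] ⊗ₘ 𝟙 (B ⊗ X)) ≫ ((ρ_ B).hom ⊗ₘ 𝟙 _) := by
    rw [fst, tensorHom_comp_tensorHom, Category.comp_id]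
  rw [pair, h', h, Comon.tensorObj_comul, Category.assoc, ← tensorμ_natural_assoc,
    tensorHom_comp_tensorHom_assoc, ComonObj.counit_comul_hom, id_tensorHom_id]
  simp only [tensorμ, braiding_tensorUnit_right, MonoidalCategory.tensorHom_def]
  monoidal

theorem pair_id_fst (B X : C) [ComonObj B] [ComonObj X] :
    pair (𝟙 (B ⊗ X)) (fst B X) =
      Δ[B] ▷ X ≫ (α_ B B X).hom ≫ B ◁ (β_ B X).hom ≫ (α_ B X B).inv := by
  have h : (𝟙 (B ⊗ X) ⊗ₘ B ◁ ε[X]) = ((𝟙 B ⊗ₘ 𝟙 X) ⊗ₘ (𝟙 B ⊗ₘ ε[X])) := by simp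
  have h' : (𝟙 (B ⊗ X) ⊗ₘ fst B X) = (𝟙 (B ⊗ X) ⊗ₘ B ◁ ε[X]) ≫ (𝟙 _ ⊗ₘ (ρ_ B).hom) := by
    rw [fst, tensorHom_comp_tensorHom, Category.comp_id]
  rw [pair, h', h, Comon.tensorObj_comul, Category.assoc, ← tensorμ_natural_assoc,
    tensorHom_comp_tensorHom_assoc, ComonObj.comul_counit_hom, id_tensorHom_id]
  simp only [tensorμ, MonoidalCategory.tensorHom_def]
  monoidal

theorem pair_fst_right {B X Y : C} [ComonObj B] [ComonObj X] (f : B ⊗ X ⟶ Y) :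
    pair f (fst B X) =
      Δ[B] ▷ X ≫ (α_ B B X).hom ≫ B ◁ (β_ B X).hom ≫ (α_ B X B).inv ≫ f ▷ B := by
  have h := pair_tensorHom (𝟙 (B ⊗ X)) (fst B X) f (𝟙 B)
  rw [Category.id_comp, Category.comp_id] at h
  rw [← h, pair_id_fst]
  simp

theorem pair_fst_left {B X Y : C} [ComonObj B] [ComonObj X] (f : B ⊗ X ⟶ Y) :
    pair (fst B X) f = Δ[B] ▷ X ≫ (α_ B B X).hom ≫ B ◁ f := by
  have h := pair_tensorHom (fst B X) (𝟙 (B ⊗ X)) (𝟙 B) f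
  rw [Category.id_comp, Category.comp_id] at h
  rw [← h, pair_fst_id]
  simp

/-- The cocommutativity axiom of actions and split extensions, stated for an arbitrary comonoid
morphism `f : B ⊗ X ⟶ Y`, makes `b ⊗ x ↦ f (b₁ ⊗ x) ⊗ b₂` a comonoid morphism. -/
theorem isComonHom_pair_fst {C : Type u} [Category.{v} C] [MonoidalCategory C]
    [SymmetricCategory C] {B X Y : C} [ComonObj B] [ComonObj X] [ComonObj Y] (f : B ⊗ X ⟶ Y)
    [IsComonHom f] (h : Δ[B] ▷ X ≫ (α_ B B X).hom ≫ B ◁ f =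
      Δ[B] ▷ X ≫ (β_ B B).hom ▷ X ≫ (α_ B B X).hom ≫ B ◁ f) :
    IsComonHom (pair f (fst B X)) := by
  apply isComonHom_pair
  rw [pair_fst_left, h, pair_fst_right]
  simp only [Category.assoc, BraidedCategory.braiding_naturality_left,
    BraidedCategory.braiding_tensor_left_hom, Iso.inv_hom_id_assoc]
  rw [← whiskerLeft_comp_assoc, SymmetricCategory.symmetry]
  simp

instance isComonHom_mul (M : C) [BimonObj M] : IsComonHom μ[M] where

instance isComonHom_counit_one (X M : C) [ComonObj X] [BimonObj M] :
    IsComonHom (ε[X] ≫ η[M]) where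
  hom_comul := by
    rw [Category.assoc, BimonObj.one_comul, ← tensorHom_comp_tensorHom,
      ComonObj.counit_comul_hom_assoc, MonObj.tensorObj.one_def]

instance isComonHom_inl (X M : C) [ComonObj X] [BimonObj M] : IsComonHom (inl X M) := by
  rw [inl_eq_pair]
  apply isComonHom_pair
  rw [← inr_eq_pair, ← inl_eq_pair]
  simp [inl, inr]

instance isComonHom_inr (M X : C) [ComonObj X] [BimonObj M] : IsComonHom (inr M X) := by
  rw [inr_eq_pair]
  apply isComonHom_pair
  rw [← inr_eq_pair, ← inl_eq_pair]
  simp [inl, inr]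

@[simp]
theorem inl_fst (X M : C) [ComonObj X] [BimonObj M] : inl X M ≫ fst X M = 𝟙 X := by
  rw [inl_eq_pair, pair_fst]

@[simp]
theorem inl_snd (X M : C) [ComonObj X] [BimonObj M] : inl X M ≫ snd X M = ε[X] ≫ η[M] := by
  rw [inl_eq_pair, pair_snd]

@[simp]
theorem inr_fst (M X : C) [ComonObj X] [BimonObj M] : inr M X ≫ fst M X = ε[X] ≫ η[M] := by
  rw [inr_eq_pair, pair_fst]

@[simp]
theorem inr_snd (M X : C) [ComonObj X] [BimonObj M] : inr M X ≫ snd M X = 𝟙 X := by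
  rw [inr_eq_pair, pair_snd]

end Comonoid

/-! ### The semidirect product of an action -/

open Comonoid

namespace HopfAction

variable {C : Type u} [Category.{v} C] [MonoidalCategory C] [SymmetricCategory C]
  (S : HopfAction C)

instance isComonHom_act : IsComonHom S.act where
  hom_counit := by rw [S.act_counit, Comon.tensorObj_counit]
  hom_comul := by rw [S.act_comul, Comon.tensorObj_comul, Category.assoc]

/-- The exchange rule `b ⊗ x ↦ (b₁ ▷ x) ⊗ b₂` of an action. -/
def swap : S.B ⊗ S.X ⟶ S.X ⊗ S.B := pair S.act (fst S.B S.X)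

instance isComonHom_swap : IsComonHom S.swap := isComonHom_pair_fst S.act S.cocomm

theorem swap_fst : S.swap ≫ fst S.X S.B = S.act := pair_fst _ _

theorem swap_snd : S.swap ≫ snd S.X S.B = fst S.B S.X := pair_snd _ _

end HopfAction

namespace Comonoid

variable {C : Type u} [Category.{v} C] [MonoidalCategory C] [BraidedCategory C]

/-- The morphism `b ⊗ x ⊗ y ↦ f (b₁ ⊗ x) ⊗ f (b₂ ⊗ y)`, written through `b ⊗ x ↦ f (b₁ ⊗ x) ⊗ b₂`.
It expresses the axiom that `B` acts compatibly with the product of `X` in terms of `swap`. -/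
theorem comul_whiskerRight_tensorμ {B X : C} [ComonObj B] [ComonObj X] (f : B ⊗ X ⟶ X) :
    Δ[B] ▷ (X ⊗ X) ≫ tensorμ B B X X ≫ (f ⊗ₘ f) =
      (α_ B X X).inv ≫ pair f (fst B X) ▷ X ≫ (α_ X B X).hom ≫ X ◁ f := by
  rw [pair_fst_right, tensorμ, MonoidalCategory.tensorHom_def]
  monoidal

end Comonoid

namespace HopfAction

variable {C : Type u} [Category.{v} C] [MonoidalCategory C] [SymmetricCategory C]
  (S : HopfAction C)

/-- The exchange rule of an action is a distributive law. All four identities are between comonoid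
morphisms, so they are checked on the two projections: the first one gives the axioms of the action,
the second one gives identities between projections. -/
def distributiveLaw : DistributiveLaw S.X S.B where
  swap := S.swap
  one_left := by
    have h : inr S.B S.X ≫ S.swap = inl S.X S.B := by
      apply hom_ext
      · rw [Category.assoc, swap_fst, inl_fst, inr, Category.assoc, S.one_act, Iso.inv_hom_id]
      · rw [Category.assoc, swap_snd, inl_snd, inr_fst]
    rwa [inr, inl, Category.assoc, Iso.inv_comp_eq] at h
  one_right := by
    have h : inl S.B S.X ≫ S.swap = inr S.X S.B := by
      apply hom_ext
      · rw [Category.assoc, swap_fst, inr_fst, inl, Category.assoc, S.act_one,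
          Iso.inv_hom_id_assoc]
      · rw [Category.assoc, swap_snd, inr_snd, inl_fst]
    rwa [inr, inl, Category.assoc, Iso.inv_comp_eq] at h
  mul_left := by
    apply hom_ext
    · simp only [Category.assoc, swap_fst, whiskerLeft_fst, associator_hom_fst,
        reassoc_of% @whiskerRight_fst, reassoc_of% @associator_inv_fst]
      rw [← whiskerLeft_comp_assoc, swap_fst, S.mul_act]
    · simp only [Category.assoc, swap_snd, whiskerRight_fst, whiskerLeft_snd,
        reassoc_of% @associator_hom_snd_whiskerRight]
      rw [← comp_whiskerRight_assoc, swap_snd, ← associator_hom_whiskerLeft_snd,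
        Category.assoc, Iso.inv_hom_id_assoc, ← whiskerLeft_comp_assoc, swap_snd,
        reassoc_of% @associator_hom_whiskerLeft_fst]
  mul_right := by
    apply hom_ext
    · simp only [Category.assoc, swap_fst, whiskerRight_fst, reassoc_of% @associator_inv_fst]
      rw [← whiskerLeft_comp_assoc, swap_fst, S.act_mul]
      have h := comul_whiskerRight_tensorμ S.act
      simp only [reassoc_of% h, swap]
    · simp only [Category.assoc, swap_snd, whiskerRight_snd, associator_inv_snd,
        reassoc_of% @whiskerLeft_snd, reassoc_of% @associator_hom_snd_whiskerRight, whiskerLeft_fst]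
      rw [← comp_whiskerRight_assoc, swap_snd, whiskerRight_fst, reassoc_of% @associator_inv_fst,
        whiskerLeft_fst]

/-- The semidirect product multiplication `(x ⊗ b) (x' ⊗ b') = x (b₁ ▷ x') ⊗ b₂ b'`. -/
def mul : (S.X ⊗ S.B) ⊗ (S.X ⊗ S.B) ⟶ S.X ⊗ S.B := S.distributiveLaw.mul

theorem mul_eq : S.mul = (α_ S.X S.B (S.X ⊗ S.B)).hom ≫
    S.X ◁ ((α_ S.B S.X S.B).inv ≫ S.swap ▷ S.B ≫ (α_ S.X S.B S.B).hom) ≫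
    (α_ S.X S.X (S.B ⊗ S.B)).inv ≫ (μ[S.X] ⊗ₘ μ[S.B]) := rfl

instance isComonHom_mul : IsComonHom S.mul := by
  rw [mul_eq]; infer_instance

theorem mul_fst : S.mul ≫ fst S.X S.B =
    (α_ S.X S.B (S.X ⊗ S.B)).hom ≫ S.X ◁ (S.B ◁ fst S.X S.B ≫ S.act) ≫ μ[S.X] := by
  simp only [mul_eq, Category.assoc, tensorHom_fst, reassoc_of% @associator_inv_fst]
  rw [← whiskerLeft_comp_assoc]
  simp only [Category.assoc, associator_hom_fst, reassoc_of% @whiskerRight_fst, swap_fst,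
    reassoc_of% @associator_inv_fst]

theorem mul_snd : S.mul ≫ snd S.X S.B = (snd S.X S.B ⊗ₘ snd S.X S.B) ≫ μ[S.B] := by
  simp only [mul_eq, Category.assoc, tensorHom_snd, reassoc_of% @associator_inv_snd]
  rw [reassoc_of% @whiskerLeft_snd]
  simp only [Category.assoc, reassoc_of% @associator_hom_snd_whiskerRight]
  rw [← comp_whiskerRight_assoc, swap_snd, ← associator_hom_whiskerLeft_snd,
        Category.assoc, Iso.inv_hom_id_assoc,
        MonoidalCategory.tensorHom_def, Category.assoc]

theorem inl_mul_fst {T : C} (h : T ⟶ S.X ⊗ S.B) :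
    (inl S.X S.B ⊗ₘ h) ≫ S.mul ≫ fst S.X S.B = S.X ◁ (h ≫ fst S.X S.B) ≫ μ[S.X] := by
  rw [mul_fst, MonoidalCategory.tensorHom_def, inl]
  calc
    _ = (ρ_ S.X).inv ▷ T ≫ (α_ _ _ _).hom ≫ S.X ◁ ((𝟙_ C) ◁ (h ≫ fst S.X S.B) ≫
      η[S.B] ▷ S.X ≫ S.act) ≫ μ[S.X] := by
        rw [whisker_exchange_assoc]; monoidal
    _ = _ := by rw [S.one_act]; monoidal

theorem inr_mul_fst {T : C} (h : T ⟶ S.X ⊗ S.B) :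
    (inr S.X S.B ⊗ₘ h) ≫ S.mul ≫ fst S.X S.B = S.B ◁ (h ≫ fst S.X S.B) ≫ S.act := by
  rw [mul_fst, MonoidalCategory.tensorHom_def, inr]
  calc
    _ = 𝟙 _ ⊗≫ (η[S.X] ▷ (S.B ⊗ T) ≫ S.X ◁ (S.B ◁ (h ≫ fst S.X S.B) ≫ S.act)) ⊗≫ μ[S.X] := by
        monoidal
    _ = 𝟙 _ ⊗≫ S.B ◁ (h ≫ fst S.X S.B) ⊗≫ S.act ⊗≫ η[S.X] ▷ S.X ≫ μ[S.X] := by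
        rw [← whisker_exchange]; monoidal
    _ = _ := by rw [MonObj.one_mul]; monoidal

theorem inl_inl_mul : (inl S.X S.B ⊗ₘ inl S.X S.B) ≫ S.mul = μ[S.X] ≫ inl S.X S.B := by
  apply hom_ext
  · rw [Category.assoc, inl_mul_fst]; simp
  · rw [Category.assoc, mul_snd, tensorHom_comp_tensorHom_assoc, inl_snd,
      counit_one_tensorHom_mul, Category.assoc, inl_snd, IsComonHom.hom_counit_assoc,
      IsComonHom.hom_counit_assoc]

theorem inr_inr_mul : (inr S.X S.B ⊗ₘ inr S.X S.B) ≫ S.mul = μ[S.B] ≫ inr S.X S.B := by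
  apply hom_ext
  · rw [Category.assoc, inr_mul_fst, Category.assoc, inr_fst, IsComonHom.hom_counit_assoc,
      MonoidalCategory.whiskerLeft_comp, Category.assoc, S.act_one,
      ← IsComonHom.hom_counit_assoc (fst S.B S.B), fst, Category.assoc]
  · rw [Category.assoc, mul_snd, tensorHom_comp_tensorHom_assoc]; simp

theorem inl_inr_mul : (inl S.X S.B ⊗ₘ inr S.X S.B) ≫ S.mul = 𝟙 _ := by
  apply hom_ext
  · rw [Category.assoc, inl_mul_fst, inr_fst, ← id_tensorHom, tensorHom_counit_one_mul,
      Category.comp_id, Category.id_comp]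
  · rw [Category.assoc, mul_snd, tensorHom_comp_tensorHom_assoc, inl_snd, inr_snd,
      counit_one_tensorHom_mul, Category.comp_id, Category.id_comp]

theorem inr_inl_mul_fst :
    (inr S.X S.B ⊗ₘ inl S.X S.B) ≫ S.mul ≫ fst S.X S.B = S.act := by
  rw [inr_mul_fst]; simp

/-- The semidirect product monoid on `X ⊗ B`. It is not an instance, because `X ⊗ B` already carries
the instance of the tensor product monoid, in which `X` and `B` commute. -/
abbrev semidirectMon : MonObj (S.X ⊗ S.B) where
  one := (λ_ (𝟙_ C)).inv ≫ (η[S.X] ⊗ₘ η[S.B])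
  mul := S.mul
  one_mul := S.distributiveLaw.one_mul
  mul_one := S.distributiveLaw.mul_one
  mul_assoc := S.distributiveLaw.mul_assoc

end HopfAction

/-! ### Convolution and the antipode of the semidirect product -/

namespace Comonoid

variable {C : Type u} [Category.{v} C] [MonoidalCategory C]

/-- A morphism from a comonoid to a monoid, seen as an element of the convolution monoid. -/
abbrev toConv {T A : C} (f : T ⟶ A) : Conv T A := f

theorem convMul_eq {T A : C} [ComonObj T] [MonObj A] (f g : T ⟶ A) :
    toConv f * toConv g = pair f g ≫ μ[A] := by
  rw [Conv.mul_eq, pair, MonoidalCategory.tensorHom_def]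
  simp only [Category.assoc]
  rfl

/-- A comonoid morphism into a Hopf algebra followed by a monoid morphism has the convolution
inverse obtained by inserting the antipode. -/
theorem convMul_antipode_left [BraidedCategory C] {T H A : C} [ComonObj T] [HopfObj H]
    [MonObj A] (f : T ⟶ H) [IsComonHom f] (g : H ⟶ A) [IsMonHom g] :
    toConv (f ≫ HopfObj.antipode ≫ g) * toConv (f ≫ g) = 1 := by
  rw [convMul_eq, Conv.one_eq, ← reassoc_of% @comp_pair]
  have h := pair_tensorHom (HopfObj.antipode (X := H)) (𝟙 H) g g
  rw [Category.id_comp] at h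
  rw [← h, Category.assoc, ← IsMonHom.mul_hom, pair, tensorHom_id, Category.assoc,
    HopfObj.antipode_left_assoc, IsMonHom.one_hom, IsComonHom.hom_counit_assoc]

theorem convMul_antipode_right [BraidedCategory C] {T H A : C} [ComonObj T] [HopfObj H]
    [MonObj A] (f : T ⟶ H) [IsComonHom f] (g : H ⟶ A) [IsMonHom g] :
    toConv (f ≫ g) * toConv (f ≫ HopfObj.antipode ≫ g) = 1 := by
  rw [convMul_eq, Conv.one_eq, ← reassoc_of% @comp_pair]
  have h := pair_tensorHom (𝟙 H) (HopfObj.antipode (X := H)) g g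
  rw [Category.id_comp] at h
  rw [← h, Category.assoc, ← IsMonHom.mul_hom, pair, id_tensorHom, Category.assoc,
    HopfObj.antipode_right_assoc, IsMonHom.one_hom, IsComonHom.hom_counit_assoc]

end Comonoid

namespace HopfAction

variable {C : Type u} [Category.{v} C] [MonoidalCategory C] [SymmetricCategory C]
  (S : HopfAction C)

theorem one_comp_inl : η[S.X] ≫ inl S.X S.B = (λ_ (𝟙_ C)).inv ≫ (η[S.X] ⊗ₘ η[S.B]) := by
  rw [inl, rightUnitor_inv_naturality_assoc, MonoidalCategory.tensorHom_def, unitors_inv_equal]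

theorem one_comp_inr : η[S.B] ≫ inr S.X S.B = (λ_ (𝟙_ C)).inv ≫ (η[S.X] ⊗ₘ η[S.B]) := by
  rw [inr, leftUnitor_inv_naturality_assoc, MonoidalCategory.tensorHom_def']

theorem isMonHom_inl : letI := S.semidirectMon; IsMonHom (inl S.X S.B) :=
  letI := S.semidirectMon
  { one_hom := S.one_comp_inl
    mul_hom := S.inl_inl_mul.symm }

theorem isMonHom_inr : letI := S.semidirectMon; IsMonHom (inr S.X S.B) :=
  letI := S.semidirectMon
  { one_hom := S.one_comp_inr
    mul_hom := S.inr_inr_mul.symm }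

theorem isMonHom_snd : letI := S.semidirectMon; IsMonHom (snd S.X S.B) :=
  letI := S.semidirectMon
  { one_hom := by
      change ((λ_ (𝟙_ C)).inv ≫ (η[S.X] ⊗ₘ η[S.B])) ≫ _ = _
      rw [← S.one_comp_inr, Category.assoc, inr_snd, Category.comp_id]
    mul_hom := S.mul_snd }

/-- The antipode `x ⊗ b ↦ (1 ⊗ S b) (S x ⊗ 1)` of the semidirect product, that is the convolution
product of the inverses of the two factors in `convMul_inl_inr`, in the opposite order. -/
def antipode : S.X ⊗ S.B ⟶ S.X ⊗ S.B :=
  pair (snd S.X S.B ≫ HopfObj.antipode ≫ inr S.X S.B)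
    (fst S.X S.B ≫ HopfObj.antipode ≫ inl S.X S.B) ≫ S.mul

/-- The unit of `X ⊗ B` is grouplike. It is written out as a composite because `η` would refer to a
chosen monoid structure on `X ⊗ B`. -/
theorem one_comp_comul : ((λ_ (𝟙_ C)).inv ≫ (η[S.X] ⊗ₘ η[S.B])) ≫ Δ[S.X ⊗ S.B] =
    (λ_ (𝟙_ C)).inv ≫ ((λ_ (𝟙_ C)).inv ≫ (η[S.X] ⊗ₘ η[S.B]) ⊗ₘ
      (λ_ (𝟙_ C)).inv ≫ (η[S.X] ⊗ₘ η[S.B])) := by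
  rw [← one_comp_inl, Category.assoc, IsComonHom.hom_comul, BimonObj.one_comul_assoc,
    MonObj.tensorObj.one_def, Category.assoc, tensorHom_comp_tensorHom]

theorem one_comp_counit :
    ((λ_ (𝟙_ C)).inv ≫ (η[S.X] ⊗ₘ η[S.B])) ≫ ε[S.X ⊗ S.B] = 𝟙 (𝟙_ C) := by
  rw [← one_comp_inl, Category.assoc, IsComonHom.hom_counit, BimonObj.one_counit]

/-- The identity of `X ⊗ B` is the convolution product of its two components, since
`x ⊗ b = (x ⊗ 1) (1 ⊗ b)`. -/
theorem convMul_inl_inr : letI := S.semidirectMon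
    toConv (fst S.X S.B ≫ inl S.X S.B) * toConv (snd S.X S.B ≫ inr S.X S.B) =
      toConv (𝟙 (S.X ⊗ S.B)) := by
  let _ := S.semidirectMon
  rw [convMul_eq, ← pair_tensorHom, pair_fst_snd, Category.id_comp]
  exact S.inl_inr_mul

theorem antipode_eq : letI := S.semidirectMon
    toConv S.antipode = toConv (snd S.X S.B ≫ HopfObj.antipode ≫ inr S.X S.B) *
      toConv (fst S.X S.B ≫ HopfObj.antipode ≫ inl S.X S.B) := by
  let _ := S.semidirectMon
  rw [convMul_eq]; rfl

theorem antipode_left : letI := S.semidirectMon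
    Δ[S.X ⊗ S.B] ≫ S.antipode ▷ (S.X ⊗ S.B) ≫ μ[S.X ⊗ S.B] = ε[S.X ⊗ S.B] ≫ η[S.X ⊗ S.B] := by
  let _ := S.semidirectMon
  have := S.isMonHom_inl
  have := S.isMonHom_inr
  have h : toConv S.antipode * toConv (𝟙 (S.X ⊗ S.B)) = 1 := by
    rw [antipode_eq, ← convMul_inl_inr, mul_assoc,
      ← mul_assoc (toConv (fst S.X S.B ≫ HopfObj.antipode ≫ inl S.X S.B)),
      convMul_antipode_left, one_mul, convMul_antipode_left]
  rwa [convMul_eq, pair, tensorHom_id, Category.assoc] at h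

theorem antipode_right : letI := S.semidirectMon
    Δ[S.X ⊗ S.B] ≫ (S.X ⊗ S.B) ◁ S.antipode ≫ μ[S.X ⊗ S.B] = ε[S.X ⊗ S.B] ≫ η[S.X ⊗ S.B] := by
  let _ := S.semidirectMon
  have := S.isMonHom_inl
  have := S.isMonHom_inr
  have h : toConv (𝟙 (S.X ⊗ S.B)) * toConv S.antipode = 1 := by
    rw [antipode_eq, ← convMul_inl_inr, mul_assoc,
      ← mul_assoc (toConv (snd S.X S.B ≫ inr S.X S.B)),
      convMul_antipode_right, one_mul, convMul_antipode_right]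
  rwa [convMul_eq, pair, id_tensorHom, Category.assoc] at h

/-- The semidirect product Hopf algebra on `X ⊗ B`: the tensor product comonoid with the semidirect
product multiplication. -/
abbrev semidirectHopf : HopfObj (S.X ⊗ S.B) where
  toMonObj := S.semidirectMon
  toComonObj := inferInstance
  mul_comul := by
    change S.mul ≫ Δ[S.X ⊗ S.B] = (Δ[S.X ⊗ S.B] ⊗ₘ Δ[S.X ⊗ S.B]) ≫ _ ≫ (S.mul ⊗ₘ S.mul)
    rw [IsComonHom.hom_comul, Comon.tensorObj_comul (S.X ⊗ S.B), Category.assoc]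
  one_comul := S.one_comp_comul
  mul_counit := IsComonHom.hom_counit S.mul
  one_counit := S.one_comp_counit
  antipode := S.antipode
  antipode_left := S.antipode_left
  antipode_right := S.antipode_right

/-- The split extension of `B` by `X` given by the semidirect product `X ⊗ B`. -/
abbrev toSplitExt : HopfSplitExt C :=
  letI := S.semidirectHopf
  { X := S.X
    A := S.X ⊗ S.B
    B := S.B
    κ := inl S.X S.B
    α := snd S.X S.B
    e := inr S.X S.B
    ret := fst S.X S.B
    isBimonHom_κ :=
      { toIsMonHom := S.isMonHom_inl
        toIsComonHom := isComonHom_inl _ _ }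
    isBimonHom_α :=
      { toIsMonHom := S.isMonHom_snd
        toIsComonHom := isComonHom_snd _ _ }
    isBimonHom_e :=
      { toIsMonHom := S.isMonHom_inr
        toIsComonHom := isComonHom_inr _ _ }
    κ_ret := inl_fst _ _
    e_α := inr_snd _ _
    e_ret := inr_fst _ _
    κ_α := inl_snd _ _
    decomp := by
      have h : pair (fst S.X S.B ≫ inl S.X S.B) (snd S.X S.B ≫ inr S.X S.B) ≫ S.mul = 𝟙 _ := by
        rw [← pair_tensorHom, pair_fst_snd, Category.id_comp, inl_inr_mul]
      rwa [pair, Category.assoc] at h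
    mul_ret := (reassoc_of% S.inl_inr_mul) (fst S.X S.B)
    cocomm := by
      have h := S.cocomm
      rw [← S.inr_inl_mul_fst] at h
      exact h
    isComonHom_ret := isComonHom_fst _ _
    one_ret := by
      change ((λ_ (𝟙_ C)).inv ≫ (η[S.X] ⊗ₘ η[S.B])) ≫ _ = _
      rw [← S.one_comp_inl, Category.assoc, inl_fst, Category.comp_id] }

end HopfAction

/-! ### Products of two monoid morphisms that satisfy an exchange rule -/

section factorization

variable {C : Type u} [Category.{v} C] [MonoidalCategory C]

/-- Associativity for the product of three morphisms into a monoid. -/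
theorem tensorHom_mul_tensorHom_mul {U V W A : C} [MonObj A] (f : U ⟶ A) (g : V ⟶ A)
    (h : W ⟶ A) :
    ((f ⊗ₘ g) ≫ μ[A] ⊗ₘ h) ≫ μ[A] = (α_ U V W).hom ≫ (f ⊗ₘ (g ⊗ₘ h) ≫ μ[A]) ≫ μ[A] := by
  have h₁ : ((f ⊗ₘ g) ≫ μ[A] ⊗ₘ h) = ((f ⊗ₘ g) ⊗ₘ h) ≫ μ[A] ▷ A := by
    rw [← tensorHom_id, tensorHom_comp_tensorHom, Category.comp_id]
  have h₂ : (f ⊗ₘ (g ⊗ₘ h) ≫ μ[A]) = (f ⊗ₘ (g ⊗ₘ h)) ≫ A ◁ μ[A] := by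
    rw [← id_tensorHom, tensorHom_comp_tensorHom, Category.comp_id]
  rw [h₁, h₂, Category.assoc, MonObj.mul_assoc, Category.assoc, associator_naturality_assoc]

variable {X B A : C} [MonObj A] (k : X ⟶ A) (e : B ⟶ A) (s : B ⊗ X ⟶ X ⊗ B)

/-- If `e b * k x` is rewritten by the exchange rule `s` with the value of `k` in front, then so is
`e (b b') * k x`, by applying `s` twice. -/
theorem mul_whiskerRight_of_swap [MonObj B] [IsMonHom e]
    (hs : (e ⊗ₘ k) ≫ μ[A] = s ≫ (k ⊗ₘ e) ≫ μ[A]) :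
    μ[B] ▷ X ≫ (e ⊗ₘ k) ≫ μ[A] = (α_ B B X).hom ≫ B ◁ s ≫ (α_ B X B).inv ≫ s ▷ B ≫
      (α_ X B B).hom ≫ X ◁ μ[B] ≫ (k ⊗ₘ e) ≫ μ[A] := by
  have h₁ : μ[B] ▷ X ≫ (e ⊗ₘ k) ≫ μ[A] =
      (α_ B B X).hom ≫ B ◁ s ≫ (e ⊗ₘ (k ⊗ₘ e) ≫ μ[A]) ≫ μ[A] := by
    rw [← tensorHom_id, tensorHom_comp_tensorHom_assoc, IsMonHom.mul_hom, Category.id_comp,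
      tensorHom_mul_tensorHom_mul, hs, ← id_tensorHom, tensorHom_comp_tensorHom_assoc,
      Category.id_comp]
  have h₂ : (e ⊗ₘ (k ⊗ₘ e) ≫ μ[A]) ≫ μ[A] =
      (α_ B X B).inv ≫ s ▷ B ≫ ((k ⊗ₘ e) ≫ μ[A] ⊗ₘ e) ≫ μ[A] := by
    rw [Iso.eq_inv_comp, ← tensorHom_mul_tensorHom_mul, hs, ← tensorHom_id,
      tensorHom_comp_tensorHom_assoc, Category.id_comp]
  rw [h₁, h₂, tensorHom_mul_tensorHom_mul, ← IsMonHom.mul_hom, ← id_tensorHom X,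
    tensorHom_comp_tensorHom_assoc, Category.id_comp]

/-- If `e b * k x` is rewritten by the exchange rule `s` with the value of `k` in front, then so is
`e b * k (x x')`, by applying `s` twice. -/
theorem whiskerLeft_mul_of_swap [MonObj X] [IsMonHom k]
    (hs : (e ⊗ₘ k) ≫ μ[A] = s ≫ (k ⊗ₘ e) ≫ μ[A]) :
    B ◁ μ[X] ≫ (e ⊗ₘ k) ≫ μ[A] = (α_ B X X).inv ≫ s ▷ X ≫ (α_ X B X).hom ≫ X ◁ s ≫
      (α_ X X B).inv ≫ μ[X] ▷ B ≫ (k ⊗ₘ e) ≫ μ[A] := by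
  have h₁ : B ◁ μ[X] ≫ (e ⊗ₘ k) ≫ μ[A] =
      (α_ B X X).inv ≫ s ▷ X ≫ ((k ⊗ₘ e) ≫ μ[A] ⊗ₘ k) ≫ μ[A] := by
    rw [← id_tensorHom, tensorHom_comp_tensorHom_assoc, IsMonHom.mul_hom, Category.id_comp,
      Iso.eq_inv_comp, ← tensorHom_mul_tensorHom_mul, hs, ← tensorHom_id,
      tensorHom_comp_tensorHom_assoc, Category.id_comp]
  have h₂ : (k ⊗ₘ (k ⊗ₘ e) ≫ μ[A]) ≫ μ[A] =
      (α_ X X B).inv ≫ μ[X] ▷ B ≫ (k ⊗ₘ e) ≫ μ[A] := by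
    rw [Iso.eq_inv_comp, ← tensorHom_mul_tensorHom_mul, ← IsMonHom.mul_hom, ← tensorHom_id,
      tensorHom_comp_tensorHom_assoc, Category.id_comp]
  rw [h₁, tensorHom_mul_tensorHom_mul, hs, ← h₂, ← id_tensorHom X,
    tensorHom_comp_tensorHom_assoc, Category.id_comp]

/-- If `e b * k x` is rewritten by the exchange rule `s` with the value of `k` in front, then
`x ⊗ b ↦ k x * e b` is compatible with the multiplication that `s` induces on `X ⊗ B`. -/
theorem tensorHom_mul_of_swap [MonObj X] [MonObj B] [IsMonHom k] [IsMonHom e]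
    (hs : (e ⊗ₘ k) ≫ μ[A] = s ≫ (k ⊗ₘ e) ≫ μ[A]) :
    ((k ⊗ₘ e) ≫ μ[A] ⊗ₘ (k ⊗ₘ e) ≫ μ[A]) ≫ μ[A] =
      ((α_ X B (X ⊗ B)).hom ≫ X ◁ ((α_ B X B).inv ≫ s ▷ B ≫ (α_ X B B).hom) ≫
        (α_ X X (B ⊗ B)).inv ≫ (μ[X] ⊗ₘ μ[B])) ≫ (k ⊗ₘ e) ≫ μ[A] := by
  have h₁ : (e ⊗ₘ (k ⊗ₘ e) ≫ μ[A]) ≫ μ[A] =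
      ((α_ B X B).inv ≫ s ▷ B ≫ (α_ X B B).hom) ≫ (k ⊗ₘ μ[B] ≫ e) ≫ μ[A] := by
    rw [IsMonHom.mul_hom, Category.assoc, Category.assoc, ← tensorHom_mul_tensorHom_mul,
      Iso.eq_inv_comp, ← tensorHom_mul_tensorHom_mul, hs, ← tensorHom_id,
      tensorHom_comp_tensorHom_assoc, Category.id_comp]
  have h₂ : (k ⊗ₘ (k ⊗ₘ μ[B] ≫ e) ≫ μ[A]) ≫ μ[A] =
      (α_ X X (B ⊗ B)).inv ≫ (μ[X] ⊗ₘ μ[B]) ≫ (k ⊗ₘ e) ≫ μ[A] := by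
    rw [Iso.eq_inv_comp, ← tensorHom_mul_tensorHom_mul, ← IsMonHom.mul_hom,
      tensorHom_comp_tensorHom_assoc]
  rw [tensorHom_mul_tensorHom_mul, h₁]
  simp only [Category.assoc]
  rw [← h₂, ← id_tensorHom X, tensorHom_comp_tensorHom_assoc, Category.id_comp]
  simp only [Category.assoc]

end factorization

/-! ### The action of a split extension -/

namespace HopfSplitExt

variable {C : Type u} [Category.{v} C] [MonoidalCategory C] [SymmetricCategory C]
  (S : HopfSplitExt C)

/-- The action `λ m (e ⊗ κ)` of `B` on `X`. -/
def act : S.B ⊗ S.X ⟶ S.X := (S.e ⊗ₘ S.κ) ≫ μ[S.A] ≫ S.ret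

instance isComonHom_act : IsComonHom S.act := by
  unfold act; infer_instance

/-- The exchange rule `b ⊗ x ↦ (b₁ ▷ x) ⊗ b₂` of the action of a split extension. -/
def swap : S.B ⊗ S.X ⟶ S.X ⊗ S.B := pair S.act (fst S.B S.X)

theorem swap_fst : S.swap ≫ fst S.X S.B = S.act := pair_fst _ _

/-- The comparison `m (κ ⊗ e) : X ⊗ B ⟶ A`. -/
def factor : S.X ⊗ S.B ⟶ S.A := (S.κ ⊗ₘ S.e) ≫ μ[S.A]

instance isComonHom_factor : IsComonHom S.factor := by
  unfold factor; infer_instance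

theorem factor_ret : S.factor ≫ S.ret = fst S.X S.B := by
  rw [factor, Category.assoc, S.mul_ret, fst]

theorem factor_α : S.factor ≫ S.α = snd S.X S.B := by
  rw [factor, Category.assoc, IsMonHom.mul_hom, tensorHom_comp_tensorHom_assoc, S.κ_α, S.e_α,
    counit_one_tensorHom_mul, Category.comp_id]

theorem pair_ret_α_factor : pair S.ret S.α ≫ S.factor = 𝟙 S.A := by
  rw [factor, reassoc_of% pair_tensorHom S.ret S.α S.κ S.e, pair, Category.assoc, S.decomp]

theorem factor_pair_ret_α : S.factor ≫ pair S.ret S.α = 𝟙 (S.X ⊗ S.B) := by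
  rw [comp_pair, factor_ret, factor_α, pair_fst_snd]

/-- Every element of `A` factors uniquely as `κ x * e b`, with `x` and `b` given by `λ` and `α`. -/
def factorIso : S.X ⊗ S.B ≅ S.A where
  hom := S.factor
  inv := pair S.ret S.α
  hom_inv_id := S.factor_pair_ret_α
  inv_hom_id := S.pair_ret_α_factor

instance isComonHom_pair_ret_α : IsComonHom (pair S.ret S.α) := by
  have : IsComonHom S.factorIso.hom := S.isComonHom_factor
  exact inferInstanceAs (IsComonHom S.factorIso.inv)

/-- The exchange rule in `A`: `e b * κ x = κ (b₁ ▷ x) * e b₂`, found by computing the components of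
the left side under `λ` and `α`. -/
theorem tensorHom_mul_eq_swap :
    (S.e ⊗ₘ S.κ) ≫ μ[S.A] = S.swap ≫ (S.κ ⊗ₘ S.e) ≫ μ[S.A] := by
  have h : ((S.e ⊗ₘ S.κ) ≫ μ[S.A]) ≫ pair S.ret S.α = S.swap := by
    rw [comp_pair, swap, act, Category.assoc, Category.assoc, IsMonHom.mul_hom S.α,
      tensorHom_comp_tensorHom_assoc, S.κ_α, S.e_α, tensorHom_counit_one_mul, Category.comp_id]
  rw [← h, Category.assoc, ← factor, pair_ret_α_factor, Category.comp_id]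

theorem mul_act : μ[S.B] ▷ S.X ≫ S.act = (α_ _ _ _).hom ≫ S.B ◁ S.act ≫ S.act := by
  have h := mul_whiskerRight_of_swap S.κ S.e S.swap S.tensorHom_mul_eq_swap =≫ S.ret
  simp only [Category.assoc] at h
  change μ[S.B] ▷ S.X ≫ (S.e ⊗ₘ S.κ) ≫ μ[S.A] ≫ S.ret = _
  rw [h, S.mul_ret, ← fst]
  simp only [whiskerLeft_fst, associator_hom_fst, reassoc_of% @whiskerRight_fst,
    reassoc_of% @associator_inv_fst, swap_fst]
  rw [← whiskerLeft_comp_assoc, swap_fst]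

theorem act_mul : S.B ◁ μ[S.X] ≫ S.act =
    Δ[S.B] ▷ (S.X ⊗ S.X) ≫ tensorμ S.B S.B S.X S.X ≫ (S.act ⊗ₘ S.act) ≫ μ[S.X] := by
  have h := whiskerLeft_mul_of_swap S.κ S.e S.swap S.tensorHom_mul_eq_swap =≫ S.ret
  have h' := comul_whiskerRight_tensorμ S.act
  simp only [Category.assoc] at h
  rw [reassoc_of% h', act, h, S.mul_ret, ← fst]
  simp only [whiskerRight_fst, reassoc_of% @associator_inv_fst]
  rw [← whiskerLeft_comp_assoc, swap_fst]
  rfl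

/-- The action of `B` on `X` by `λ m (e ⊗ κ)`. -/
abbrev toAction : HopfAction C where
  B := S.B
  X := S.X
  act := S.act
  one_act := by
    rw [act, ← tensorHom_id, tensorHom_comp_tensorHom_assoc, IsMonHom.one_hom, Category.id_comp,
      MonoidalCategory.tensorHom_def', Category.assoc, MonObj.one_mul_assoc,
      leftUnitor_naturality_assoc, S.κ_ret, Category.comp_id]
  act_one := by
    rw [act, ← id_tensorHom, tensorHom_comp_tensorHom_assoc, IsMonHom.one_hom, Category.id_comp,
      MonoidalCategory.tensorHom_def, Category.assoc, MonObj.mul_one_assoc,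
      rightUnitor_naturality_assoc, S.e_ret]
  cocomm := S.cocomm
  act_counit := by rw [IsComonHom.hom_counit, Comon.tensorObj_counit]
  act_comul := by rw [IsComonHom.hom_comul, Comon.tensorObj_comul, Category.assoc]
  mul_act := S.mul_act
  act_mul := S.act_mul

variable (C) in
/-- The functor from split extensions to actions, which sends `(g, v, p)` to `(g, v)`. -/
def toActionFunctor : HopfSplitExt C ⥤ HopfAction C where
  obj S := S.toAction
  map {S T} f :=
    { g := Hom.g f
      v := Hom.v f
      act_comm := by
        change S.act ≫ Hom.v f = (Hom.g f ⊗ₘ Hom.v f) ≫ T.act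
        simp only [act, Category.assoc, Hom.ret_comm, tensorHom_comp_tensorHom_assoc,
          IsMonHom.mul_hom_assoc, ← Hom.κ_comm, ← Hom.e_comm] }

/-! ### The equivalence between split extensions and actions -/

variable {S} {T : HopfSplitExt C}

theorem factor_comp (f : S ⟶ T) :
    S.factor ≫ Hom.p f = (Hom.v f ⊗ₘ Hom.g f) ≫ T.factor := by
  simp only [factor, Category.assoc, tensorHom_comp_tensorHom_assoc, IsMonHom.mul_hom, Hom.κ_comm,
    Hom.e_comm]

instance : (toActionFunctor C).Faithful where
  map_injective {S T f f'} h := by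
    have hg : Hom.g f = Hom.g f' := congrArg HopfAction.Hom.g h
    have hv : Hom.v f = Hom.v f' := congrArg HopfAction.Hom.v h
    refine Hom.ext hg hv ?_
    rw [← cancel_epi S.factorIso.hom]
    change S.factor ≫ _ = S.factor ≫ _
    rw [factor_comp, factor_comp, hg, hv]

section lift

variable (g : S.B ⟶ T.B) (v : S.X ⟶ T.X)

/-- The morphism `κ x * e b ↦ κ' (v x) * e' (g b)` between the total objects of two split
extensions. -/
def lift : S.A ⟶ T.A := pair S.ret S.α ≫ (v ⊗ₘ g) ≫ T.factor

theorem factor_lift : S.factor ≫ lift g v = (v ≫ T.κ ⊗ₘ g ≫ T.e) ≫ μ[T.A] := by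
  rw [lift, reassoc_of% @factor_pair_ret_α, factor, tensorHom_comp_tensorHom_assoc]

theorem swap_comp [IsBimonHom v] [IsBimonHom g] (h : S.act ≫ v = (g ⊗ₘ v) ≫ T.act) :
    S.swap ≫ (v ⊗ₘ g) = (g ⊗ₘ v) ≫ T.swap := by
  rw [swap, swap, pair_tensorHom, comp_pair, h, tensorHom_fst]

theorem κ_lift [IsBimonHom g] : S.κ ≫ lift g v = v ≫ T.κ := by
  rw [lift, reassoc_of% @comp_pair, S.κ_ret, S.κ_α, factor, tensorHom_comp_tensorHom_assoc,
    reassoc_of% pair_tensorHom, Category.id_comp, Category.assoc, IsMonHom.one_hom_assoc,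
    IsMonHom.one_hom, pair_counit_one_mul]

theorem e_lift [IsBimonHom v] : S.e ≫ lift g v = g ≫ T.e := by
  rw [lift, reassoc_of% @comp_pair, S.e_ret, S.e_α, factor, tensorHom_comp_tensorHom_assoc,
    reassoc_of% pair_tensorHom, Category.id_comp, Category.assoc, IsMonHom.one_hom_assoc,
    IsMonHom.one_hom, pair_one_counit_mul]

theorem lift_α [IsBimonHom v] : lift g v ≫ T.α = S.α ≫ g := by
  rw [lift, Category.assoc, Category.assoc, factor_α, tensorHom_snd, reassoc_of% @pair_snd]

theorem lift_ret [IsBimonHom g] : lift g v ≫ T.ret = S.ret ≫ v := by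
  rw [lift, Category.assoc, Category.assoc, factor_ret, tensorHom_fst, reassoc_of% @pair_fst]

/-- If `g` and `v` respect the actions, they respect the exchange rules, which determine the
multiplications of the total objects; so the induced morphism is multiplicative. -/
theorem isBimonHom_lift [IsBimonHom g] [IsBimonHom v] (h : S.act ≫ v = (g ⊗ₘ v) ≫ T.act) :
    IsBimonHom (lift g v) := by
  have hs : (g ≫ T.e ⊗ₘ v ≫ T.κ) ≫ μ[T.A] = S.swap ≫ (v ≫ T.κ ⊗ₘ g ≫ T.e) ≫ μ[T.A] := by
    rw [← tensorHom_comp_tensorHom_assoc, tensorHom_mul_eq_swap, ← reassoc_of% swap_comp g v h,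
      tensorHom_comp_tensorHom_assoc]
  have : IsComonHom (lift g v) := by unfold lift; infer_instance
  refine { one_hom := ?_, mul_hom := ?_ }
  · rw [← IsMonHom.one_hom S.κ, Category.assoc, κ_lift, IsMonHom.one_hom_assoc, IsMonHom.one_hom]
  -- Multiplicativity can be tested on products of elements of the form `κ x * e b`.
  · rw [← cancel_epi (S.factorIso.hom ⊗ₘ S.factorIso.hom)]
    change (S.factor ⊗ₘ S.factor) ≫ _ = (S.factor ⊗ₘ S.factor) ≫ _
    rw [tensorHom_comp_tensorHom_assoc, factor_lift, tensorHom_mul_of_swap _ _ _ hs,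
      ← factor_lift]
    have h' := tensorHom_mul_of_swap S.κ S.e S.swap S.tensorHom_mul_eq_swap
    rw [← factor] at h'
    rw [reassoc_of% h', Category.assoc]
    simp only [Category.assoc]

end lift

instance : (toActionFunctor C).Full where
  map_surjective {S T} f := by
    have h : S.act ≫ HopfAction.Hom.v f = (HopfAction.Hom.g f ⊗ₘ HopfAction.Hom.v f) ≫ T.act :=
      HopfAction.Hom.act_comm f
    have h₁ : IsBimonHom (M := S.B) (N := T.B) (HopfAction.Hom.g f) := HopfAction.Hom.isBimonHom_g f
    have h₂ : IsBimonHom (M := S.X) (N := T.X) (HopfAction.Hom.v f) := HopfAction.Hom.isBimonHom_v f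
    have h₃ := isBimonHom_lift _ _ h
    exact ⟨{ g := HopfAction.Hom.g f, v := HopfAction.Hom.v f
             p := lift (HopfAction.Hom.g f) (HopfAction.Hom.v f)
             isBimonHom_g := h₁
             isBimonHom_v := h₂
             isBimonHom_p := h₃
             κ_comm := κ_lift _ _
             e_comm := e_lift _ _
             α_comm := (lift_α _ _).symm
             ret_comm := (lift_ret _ _).symm }, rfl⟩

instance : (toActionFunctor C).EssSurj where
  mem_essImage S := by
    have h : S.toSplitExt.act = S.act := S.inr_inl_mul_fst
    exact ⟨S.toSplitExt, ⟨
      { hom :=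
          { g := 𝟙 S.B
            v := 𝟙 S.X
            isBimonHom_g := isBimonHom_id _
            isBimonHom_v := isBimonHom_id _
            act_comm := by
              change S.toSplitExt.act ≫ 𝟙 S.X = (𝟙 S.B ⊗ₘ 𝟙 S.X) ≫ S.act
              rw [h, id_tensorHom_id, Category.id_comp, Category.comp_id] }
        inv :=
          { g := 𝟙 S.B
            v := 𝟙 S.X
            isBimonHom_g := isBimonHom_id _
            isBimonHom_v := isBimonHom_id _
            act_comm := by
              change S.act ≫ 𝟙 S.X = (𝟙 S.B ⊗ₘ 𝟙 S.X) ≫ S.toSplitExt.act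
              rw [h, id_tensorHom_id, Category.id_comp, Category.comp_id] }
        hom_inv_id := HopfAction.Hom.ext (Category.id_comp _) (Category.id_comp _)
        inv_hom_id := HopfAction.Hom.ext (Category.id_comp _) (Category.id_comp _) }⟩⟩

instance : (toActionFunctor C).IsEquivalence where

theorem isCanonical_toActionFunctor : IsCanonicalSplitExtToAction (toActionFunctor C) :=
  ⟨Iso.refl _, Iso.refl _, fun S => ⟨isBimonHom_id S.B, isBimonHom_id S.X, by
    change S.act ≫ 𝟙 S.X = (𝟙 S.B ⊗ₘ 𝟙 S.X) ≫ S.act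
    rw [id_tensorHom_id, Category.id_comp, Category.comp_id]⟩⟩

end HopfSplitExt

/-! ### Hopf algebras and their actions in the category of sets -/

/-- A group as a Hopf algebra in the category of sets, with the diagonal as comultiplication. -/
abbrev groupHopf (G : Type w) [Group G] : HopfObj (C := Type w) G where
  one := ↾fun _ : PUnit.{w + 1} => (1 : G)
  mul := ↾fun p : G × G => p.1 * p.2
  one_mul := ConcreteCategory.hom_ext _ _ fun p : PUnit.{w + 1} × G => one_mul p.2
  mul_one := ConcreteCategory.hom_ext _ _ fun p : G × PUnit.{w + 1} => mul_one p.1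
  mul_assoc := ConcreteCategory.hom_ext _ _ fun p : (G × G) × G => mul_assoc p.1.1 p.1.2 p.2
  counit := ↾fun _ : G => PUnit.unit
  comul := ↾fun g : G => (g, g)
  counit_comul := rfl
  comul_counit := rfl
  comul_assoc := rfl
  mul_comul := rfl
  one_comul := rfl
  mul_counit := rfl
  one_counit := rfl
  antipode := ↾fun g : G => g⁻¹
  antipode_left := ConcreteCategory.hom_ext _ _ fun g : G => inv_mul_cancel g
  antipode_right := ConcreteCategory.hom_ext _ _ fun g : G => mul_inv_cancel g

theorem isBimonHom_ofHom {A B : Type w} [HopfObj A] [HopfObj B] :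
    letI := hopfGroup A
    letI := hopfGroup B
    ∀ f : A →* B, IsBimonHom (TypeCat.ofHom f : A ⟶ B) := by
  intro f
  refine { one_hom := ?_, mul_hom := ?_, hom_counit := ?_, hom_comul := ?_ }
  · exact ConcreteCategory.hom_ext _ _ fun _ => f.map_one
  · exact ConcreteCategory.hom_ext _ _ fun p : A × A => f.map_mul p.1 p.2
  · exact ConcreteCategory.hom_ext _ _ fun _ => rfl
  · refine ConcreteCategory.hom_ext _ _ fun a : A => ?_
    exact (comul_type_apply B (f a)).trans
      (congrArg (fun q : A × A => ((f q.1, f q.2) : B × B)) (comul_type_apply A a)).symm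

section setActionToGroup

instance : setActionToGroup.{w}.Faithful where
  map_injective {S T f f'} h := by
    refine HopfAction.Hom.ext (ConcreteCategory.hom_ext _ _ fun b : S.B => ?_)
      (ConcreteCategory.hom_ext _ _ fun x : S.X => ?_)
    · exact DFunLike.congr_fun (congrArg GroupAction.Hom.g h) b
    · exact DFunLike.congr_fun (congrArg GroupAction.Hom.v h) x

instance : setActionToGroup.{w}.Full where
  map_surjective {S T} f :=
    ⟨{ g := TypeCat.ofHom (GroupAction.Hom.g f)
       v := TypeCat.ofHom (GroupAction.Hom.v f)
       isBimonHom_g := isBimonHom_ofHom (A := S.B) (B := T.B) (GroupAction.Hom.g f)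
       isBimonHom_v := isBimonHom_ofHom (A := S.X) (B := T.X) (GroupAction.Hom.v f)
       act_comm := ConcreteCategory.hom_ext _ _ fun p : S.B × S.X =>
        GroupAction.Hom.smul_comm f p.1 p.2 }, rfl⟩

/-- A group action as an action of Hopf algebras in the category of sets. -/
abbrev GroupAction.toHopfAction (T : GroupAction.{w}) : HopfAction (Type w) where
  B := T.B
  X := T.X
  hopfB := groupHopf T.B
  hopfX := groupHopf T.X
  act := ↾fun p : T.B × T.X => p.1 • p.2
  one_act := ConcreteCategory.hom_ext _ _ fun p : PUnit.{w + 1} × T.X => one_smul T.B p.2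
  act_one := ConcreteCategory.hom_ext _ _ fun p : T.B × PUnit.{w + 1} =>
    smul_one (N := T.X) p.1
  cocomm := rfl
  act_counit := rfl
  act_comul := rfl
  mul_act := ConcreteCategory.hom_ext _ _ fun p : (T.B × T.B) × T.X =>
    mul_smul p.1.1 p.1.2 p.2
  act_mul := ConcreteCategory.hom_ext _ _ fun p : T.B × (T.X × T.X) =>
    smul_mul' p.1 p.2.1 p.2.2

instance : setActionToGroup.{w}.EssSurj where
  mem_essImage T :=
    ⟨T.toHopfAction, ⟨
      { hom :=
          { g := { toFun := id, map_one' := rfl, map_mul' := fun _ _ => rfl }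
            v := { toFun := id, map_one' := rfl, map_mul' := fun _ _ => rfl }
            smul_comm := fun _ _ => rfl }
        inv :=
          { g := { toFun := id, map_one' := rfl, map_mul' := fun _ _ => rfl }
            v := { toFun := id, map_one' := rfl, map_mul' := fun _ _ => rfl }
            smul_comm := fun _ _ => rfl }
        hom_inv_id := rfl
        inv_hom_id := rfl }⟩⟩

instance : setActionToGroup.{w}.IsEquivalence where

end setActionToGroup

/-! ### Split extensions of groups and their conjugation actions -/

section groupSplitExtToAction

namespace GroupSplitExt

variable (S : GroupSplitExt.{w})

theorem exists_inl_mul_splitting (a : S.A) :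
    ∃ x : S.X, a = S.ext.inl x * S.splitting (S.ext.rightHom a) := by
  have h : a * (S.splitting (S.ext.rightHom a))⁻¹ ∈ S.ext.rightHom.ker := by
    rw [MonoidHom.mem_ker, map_mul, map_inv, GroupExtension.Splitting.rightHom_splitting,
      mul_inv_cancel]
  rw [← S.ext.range_inl_eq_ker_rightHom] at h
  obtain ⟨x, hx⟩ := h
  exact ⟨x, by rw [hx, inv_mul_cancel_right]⟩

/-- The retraction onto the kernel determined by the section: the unique `x` with
`a = inl x * splitting (rightHom a)`. It is not a homomorphism in general. -/
noncomputable def ret (a : S.A) : S.X := (S.exists_inl_mul_splitting a).choose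

theorem inl_ret_mul (a : S.A) :
    S.ext.inl (S.ret a) * S.splitting (S.ext.rightHom a) = a :=
  (S.exists_inl_mul_splitting a).choose_spec.symm

theorem ret_eq {a : S.A} {x : S.X} {b : S.B} (h : a = S.ext.inl x * S.splitting b) :
    S.ret a = x := by
  apply S.ext.inl_injective
  have hb : S.ext.rightHom a = b := by
    rw [h, map_mul, GroupExtension.rightHom_inl, GroupExtension.Splitting.rightHom_splitting,
      one_mul]
  have := S.inl_ret_mul a
  rw [hb] at this
  nth_rw 2 [h] at this
  exact mul_right_cancel this

theorem splitting_mul_inl (b : S.B) (x : S.X) :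
    S.splitting b * S.ext.inl x =
      S.ext.inl (S.ext.conjAct (S.splitting b) x) * S.splitting b := by
  rw [GroupExtension.inl_conjAct_comm, inv_mul_cancel_right]

end GroupSplitExt

instance : groupSplitExtToAction.{w}.Faithful where
  map_injective {S T f f'} h := by
    have hg : GroupSplitExt.Hom.g f = GroupSplitExt.Hom.g f' := congrArg GroupAction.Hom.g h
    have hv : GroupSplitExt.Hom.v f = GroupSplitExt.Hom.v f' := congrArg GroupAction.Hom.v h
    refine GroupSplitExt.Hom.ext hg hv (MonoidHom.ext fun a => ?_)
    rw [← S.inl_ret_mul a, map_mul, map_mul, GroupSplitExt.Hom.inl_comm,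
      GroupSplitExt.Hom.inl_comm, GroupSplitExt.Hom.splitting_comm,
      GroupSplitExt.Hom.splitting_comm, hg, hv]

instance : groupSplitExtToAction.{w}.Full where
  map_surjective {S T} f := by
    let g : S.B →* T.B := GroupAction.Hom.g f
    let v : S.X →* T.X := GroupAction.Hom.v f
    have hgv (b : S.B) (x : S.X) : v (S.ext.conjAct (S.splitting b) x) =
        T.ext.conjAct (T.splitting (g b)) (v x) := GroupAction.Hom.smul_comm f b x
    -- The only possible extension of `g` and `v` to the total groups.
    let p₀ (a : S.A) : T.A := T.ext.inl (v (S.ret a)) * T.splitting (g (S.ext.rightHom a))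
    have hp₀ (x : S.X) (b : S.B) : p₀ (S.ext.inl x * S.splitting b) =
        T.ext.inl (v x) * T.splitting (g b) := by
      simp only [p₀]
      rw [S.ret_eq rfl, map_mul, GroupExtension.rightHom_inl,
        GroupExtension.Splitting.rightHom_splitting, one_mul]
    let p : S.A →* T.A := MonoidHom.mk' p₀ fun a a' => by
      rw [← S.inl_ret_mul a, ← S.inl_ret_mul a']
      generalize S.ret a = x, S.ext.rightHom a = b, S.ret a' = x', S.ext.rightHom a' = b'
      have h : S.ext.inl x * S.splitting b * (S.ext.inl x' * S.splitting b') =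
          S.ext.inl (x * S.ext.conjAct (S.splitting b) x') * S.splitting (b * b') := by
        rw [mul_assoc, ← mul_assoc (S.splitting b), S.splitting_mul_inl, map_mul, map_mul]
        simp only [mul_assoc]
      rw [h, hp₀, hp₀, hp₀, mul_assoc, ← mul_assoc (T.splitting (g b)), T.splitting_mul_inl,
        map_mul, map_mul, map_mul, map_mul, hgv]
      simp only [mul_assoc]
    exact ⟨{ g := g, v := v, p := p
             inl_comm := fun x => by
               have h := hp₀ x 1
               rwa [map_one, map_one, map_one, mul_one, mul_one] at h
             splitting_comm := fun b => by
               have h := hp₀ 1 b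
               rwa [map_one, map_one, map_one, one_mul, one_mul] at h
             rightHom_comm := fun a => by
               change _ = T.ext.rightHom (p₀ a)
               simp only [p₀]
               rw [map_mul, GroupExtension.rightHom_inl,
                 GroupExtension.Splitting.rightHom_splitting, one_mul] }, rfl⟩

/-- The semidirect product of a group action, as a split extension. -/
abbrev GroupAction.toSplitExt (T : GroupAction.{w}) : GroupSplitExt.{w} where
  X := T.X
  A := T.X ⋊[MulDistribMulAction.toMulAut T.B T.X] T.B
  B := T.B
  ext := SemidirectProduct.toGroupExtension _
  splitting := SemidirectProduct.inr_splitting _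

theorem GroupAction.smul_toSplitExt (T : GroupAction.{w}) (b : T.B) (x : T.X) :
    T.toSplitExt.ext.conjAct (T.toSplitExt.splitting b) x = b • x := by
  apply T.toSplitExt.ext.inl_injective
  rw [GroupExtension.inl_conjAct_comm]
  exact ((SemidirectProduct.inl_aut (φ := MulDistribMulAction.toMulAut T.B T.X) b x).trans
    (by rw [map_inv]; rfl)).symm

instance : groupSplitExtToAction.{w}.EssSurj where
  mem_essImage T :=
    ⟨T.toSplitExt, ⟨
      { hom :=
          { g := MonoidHom.id _
            v := MonoidHom.id _
            smul_comm := T.smul_toSplitExt }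
        inv :=
          { g := MonoidHom.id _
            v := MonoidHom.id _
            smul_comm := fun b x => (T.smul_toSplitExt b x).symm }
        hom_inv_id := rfl
        inv_hom_id := rfl }⟩⟩

instance : groupSplitExtToAction.{w}.IsEquivalence where

end groupSplitExtToAction

/-! ### Comparison of the two functors to group actions -/

section comparison

/-- In the category of sets the action `λ (e b * κ x)` is conjugation by `e b`: applying `κ λ` to
`e b * κ x` divides on the right by its component `e b` in the image of the section. -/
theorem HopfSplitExt.act_eq_conjAct (S : HopfSplitExt (Type w)) (b : S.B) (x : S.X) :
    S.act ((b, x) : S.B × S.X) = (setSplitExtToGroup.obj S).ext.conjAct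
      ((setSplitExtToGroup.obj S).splitting b) x := by
  let _ := hopfGroup S.X
  let _ := hopfGroup S.A
  let _ := hopfGroup S.B
  apply (setSplitExtToGroup.obj S).ext.inl_injective
  refine Eq.trans ?_ (GroupExtension.inl_conjAct_comm _).symm
  change S.κ (S.ret (S.e b * S.κ x)) = S.e b * S.κ x * (S.e b)⁻¹
  rw [eq_mul_inv_iff_mul_eq]
  -- The comultiplication of `A` is the diagonal, so the decomposition axiom is pointwise.
  have hd (a : S.A) : S.κ (S.ret a) * S.e (S.α a) = a := by
    have h := ConcreteCategory.congr_hom S.decomp a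
    have h2 := congrArg (fun q : S.A × S.A =>
      S.κ (S.ret q.1) * S.e (S.α q.2)) (comul_type_apply S.A a)
    exact h2.symm.trans h
  have hα : S.α (S.e b * S.κ x) = b := by
    have h1 : S.α (S.e b * S.κ x) = S.α (S.e b) * S.α (S.κ x) :=
      map_mul (hopfGroupHom S.α) _ _
    have h2 : S.α (S.e b) = b := ConcreteCategory.congr_hom S.e_α b
    have h3 : S.α (S.κ x) = 1 := ConcreteCategory.congr_hom S.κ_α x
    rw [h1, h2, h3, mul_one]
  have h := hd (S.e b * S.κ x)
  rwa [hα] at h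

/-- Passing to actions and then to groups agrees with passing to groups and then to conjugation
actions; the components are identities on the underlying groups. -/
noncomputable def toActionSetComparison :
    HopfSplitExt.toActionFunctor (Type w) ⋙ setActionToGroup.{w} ≅
      setSplitExtToGroup.{w} ⋙ groupSplitExtToAction.{w} :=
  NatIso.ofComponents
    (fun S =>
      letI := hopfGroup S.X
      letI := hopfGroup S.B
      { hom :=
          { g := MonoidHom.id S.B
            v := MonoidHom.id S.X
            smul_comm := S.act_eq_conjAct }
        inv :=
          { g := MonoidHom.id S.B
            v := MonoidHom.id S.X
            smul_comm := fun b x => (S.act_eq_conjAct b x).symm }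
        hom_inv_id := rfl
        inv_hom_id := rfl })
    (fun _ => rfl)

/-- Forgetting `λ` is an equivalence because its composite with the equivalence
`groupSplitExtToAction` is isomorphic to a composite of equivalences. -/
theorem isEquivalence_setSplitExtToGroup : setSplitExtToGroup.{w}.IsEquivalence := by
  have : (setSplitExtToGroup.{w} ⋙ groupSplitExtToAction.{w}).IsEquivalence :=
    Functor.isEquivalence_of_iso toActionSetComparison
  exact Functor.isEquivalence_of_comp_right _ groupSplitExtToAction

end comparison

theorem corollary4 :
    (∀ (C : Type u) [Category.{v} C] [MonoidalCategory C] [SymmetricCategory C],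
      ∃ E : HopfSplitExt C ≌ HopfAction C, IsCanonicalSplitExtToAction E.functor) ∧
    (setSplitExtToGroup.{w}.IsEquivalence ∧
      setActionToGroup.{w}.IsEquivalence ∧
      groupSplitExtToAction.{w}.IsEquivalence ∧
      ∃ E : HopfSplitExt (Type w) ≌ HopfAction (Type w),
        IsCanonicalSplitExtToAction E.functor ∧
        Nonempty (E.functor ⋙ setActionToGroup.{w} ≅
          setSplitExtToGroup.{w} ⋙ groupSplitExtToAction.{w})) :=
  ⟨fun C _ _ _ => ⟨(HopfSplitExt.toActionFunctor C).asEquivalence,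
      HopfSplitExt.isCanonical_toActionFunctor⟩,
    isEquivalence_setSplitExtToGroup, inferInstance, inferInstance,
    (HopfSplitExt.toActionFunctor (Type w)).asEquivalence,
    HopfSplitExt.isCanonical_toActionFunctor, ⟨toActionSetComparison⟩⟩
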